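/- Let $a>0$ be a real number. The Buckley--Osthus random graph $H_{a,1}^n$ is constructed inductively: $H_{a,1}^0$ is the empty graph and, for $t\ge 1$, $H_{a,1}^t$ is obtained from $H_{a,1}^{t-1}$ by adding a vertex $t$ and one edge between $t$ and a random vertex $i\in\{1,\dots,t\}$, where, conditionally on $H_{a,1}^{t-1}$, $\Pr(i=s)=\frac{d_{H_{a,1}^{t-1}}(s)-1+a}{(a+1)t-1}$ for $1\le s\le t-1$ and $\Pr(i=t)=\frac{a}{(a+1)t-1}$; here $d_G(s)$ is the degree of $s$ in $G$, a loop contributing $2$. The second degree of a vertex $t$ is the number of edges that are incident to a neighbor of $t$ and not incident to $t$ itself. Let $X_n(k)$ be the number of vertices of $H_{a,1}^n$ with second degree exactly $k$. Then $\mathbb{E}X_n(k)=\Theta\left(\frac{n}{k^{1+a}}\right)$ for $k=O\left(n^{1/(1+a)}\right)$, $k\ge 1$. That is, for every $C>0$ there are constants $c_1,c_2>0$ and $n_0$, depending only on $a$ and $C$, such that for all $n\ge n_0$ and all integers $k$ with $1\le k\le C\,n^{1/(1+a)}$, $$c_1\,\frac{n}{k^{1+a}}\le \mathbb{E}X_n(k)\le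 c_2\,\frac{n}{k^{1+a}}.$$ -/

import Mathlib

noncomputable section

namespace BuckleyOsthus

/-- A possible outcome of the construction of the graph on `n` vertices.  The vertices
`1, …, n` are represented by `0, …, n - 1 : Fin n`; each vertex `i` sends exactly one edge, to the
vertex `g i ≤ i` (it is a loop when `g i = i`). -/
abbrev Graph (n : ℕ) : Type := (i : Fin n) → Fin (i.val + 1)

/-- The endpoint, as a vertex of the graph, of the edge sent by the vertex `i`. -/
def target {n : ℕ} (g : Graph n) (i : Fin n) : Fin n :=
  ⟨(g i).val, lt_of_lt_of_le (g i).isLt i.isLt⟩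

/-- The `i`-th edge of the graph (the one sent by vertex `i`), as an unordered pair. -/
def edge {n : ℕ} (g : Graph n) (i : Fin n) : Sym2 (Fin n) := s(i, target g i)

/-- The degree of a vertex; a loop contributes `2`. -/
def degree {n : ℕ} (g : Graph n) (v : Fin n) : ℕ :=
  ∑ i : Fin n, ((if i = v then 1 else 0) + (if target g i = v then 1 else 0))

/-- The graph contains an edge between `u` and `v`. -/
def HasEdge {n : ℕ} (g : Graph n) (u v : Fin n) : Prop := ∃ i : Fin n, edge g i = s(u, v)

open Classical in
/-- The second degree of `t`: the number of edges which are incident to a neighbor of `t` and are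
not incident to `t` itself. -/
def secondDegree {n : ℕ} (g : Graph n) (t : Fin n) : ℕ :=
  (Finset.univ.filter fun e : Fin n =>
    t ∉ edge g e ∧ ∃ u ∈ edge g e, u ≠ t ∧ HasEdge g u t).card

/-- The number of vertices of second degree exactly `k`. -/
def X {n : ℕ} (g : Graph n) (k : ℕ) : ℕ :=
  (Finset.univ.filter fun t : Fin n => secondDegree g t = k).card

/-- The probability that the vertex number `n + 1`, added to a graph `g` on `n` vertices, sends its
edge to `s` (`s.val = n` is the new vertex itself). -/
def stepProb (a : ℝ) {n : ℕ} (g : Graph n) (s : Fin (n + 1)) : ℝ :=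
  if h : s.val < n then ((degree g ⟨s.val, h⟩ : ℝ) - 1 + a) / ((a + 1) * ((n : ℝ) + 1) - 1)
  else a / ((a + 1) * ((n : ℝ) + 1) - 1)

theorem one_le_degree {n : ℕ} (g : Graph n) (v : Fin n) : 1 ≤ degree g v := by
  unfold degree
  refine le_trans ?_ (Finset.single_le_sum (fun i _ => Nat.zero_le _) (Finset.mem_univ v))
  simp

theorem sum_degree {n : ℕ} (g : Graph n) : ∑ v : Fin n, degree g v = 2 * n := by
  unfold degree
  rw [Finset.sum_comm]
  simp only [Finset.sum_add_distrib, Finset.sum_ite_eq, Finset.mem_univ, if_true, Finset.sum_const,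
    Finset.card_univ, Fintype.card_fin, smul_eq_mul]
  omega

theorem den_pos {a : ℝ} (ha : 0 < a) (n : ℕ) : 0 < (a + 1) * ((n : ℝ) + 1) - 1 := by
  have : (0 : ℝ) ≤ n := Nat.cast_nonneg n
  nlinarith [mul_nonneg ha.le this]

theorem stepProb_nonneg {a : ℝ} (ha : 0 < a) {n : ℕ} (g : Graph n) (s : Fin (n + 1)) :
    0 ≤ stepProb a g s := by
  have hd := den_pos ha n
  unfold stepProb
  split_ifs with h
  · have h1 : (1 : ℝ) ≤ degree g ⟨s.val, h⟩ := by exact_mod_cast one_le_degree g ⟨s.val, h⟩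
    exact div_nonneg (by linarith) hd.le
  · exact div_nonneg ha.le hd.le

theorem sum_stepProb {a : ℝ} (ha : 0 < a) {n : ℕ} (g : Graph n) :
    ∑ s : Fin (n + 1), stepProb a g s = 1 := by
  have hd := den_pos ha n
  have hs : ∑ v : Fin n, (degree g v : ℝ) = 2 * n := by exact_mod_cast sum_degree g
  rw [Fin.sum_univ_castSucc]
  simp only [stepProb, Fin.val_castSucc, Fin.is_lt, dite_true, Fin.val_last, lt_irrefl,
    dite_false, Fin.eta]
  rw [← Finset.sum_div, ← add_div, div_eq_one_iff_eq hd.ne']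
  simp only [Finset.sum_add_distrib, Finset.sum_sub_distrib, hs, Finset.sum_const,
    Finset.card_univ, Fintype.card_fin, nsmul_eq_mul]
  ring

/-- The law of the endpoint of the edge sent by the new vertex. -/
def step {a : ℝ} (ha : 0 < a) {n : ℕ} (g : Graph n) : PMF (Fin (n + 1)) :=
  PMF.ofFintype (fun s => ENNReal.ofReal (stepProb a g s)) (by
    rw [← ENNReal.ofReal_sum_of_nonneg (fun s _ => stepProb_nonneg ha g s), sum_stepProb ha g,
      ENNReal.ofReal_one])

/-- The graph obtained from `g` by adding a vertex, whose edge goes to `s`. -/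
def extend {n : ℕ} (g : Graph n) (s : Fin (n + 1)) : Graph (n + 1) :=
  Fin.snoc (α := fun i : Fin (n + 1) => Fin (i.val + 1)) g s

/-- The law of the Buckley–Osthus random graph on `n` vertices, with one edge per vertex and
initial attractiveness `a`. -/
def law {a : ℝ} (ha : 0 < a) : (n : ℕ) → PMF (Graph n)
  | 0 => PMF.pure (fun i => i.elim0)
  | n + 1 => (law ha n).bind fun g => (step ha g).map (extend g)

/-- The expectation of the number of vertices of second degree exactly `k`. -/
def expectedX {a : ℝ} (ha : 0 < a) (n k : ℕ) : ℝ :=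
  ∑ g : Graph n, (law ha n g).toReal * (X g k : ℝ)

end BuckleyOsthus

end

/-! The second degree of `t` equals the sum `nbrWeight` of the in-degrees of its neighbours, up to a
correction of at most 1 (`secondDegree_eq_sum`). Let `x` be the in-degree of a vertex, `y` its
`nbrWeight` and `D = den a n`, of order `n`. One step raises `x` with probability `(x + a) / D` and
`y` with probability `(y + a * (number of neighbours)) / D`. Hence the expected numbers of vertices
of given type satisfy closed linear recursions (`degCount_succ`, `properCount_succ`,
`classCount_succ`, `leafCount_succ`), and both bounds come from comparison with explicit functions,
by induction on `n`.

The exponent arises at birth. About `n * y ^ (-(2 + a))` vertices have in-degree near `y`, each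
attracts the new vertex with probability of order `y / n`, and the newborn leaf then has weight
about `y`. So leaves of weight `y` are born at rate `y ^ (-(1 + a))` per step.

Upper bound: `degCount_le` bounds the degree counts, and `classCount_le` shows that `M * D * profile
a x y` dominates the joint counts. The profile decays like `y ^ (-(1 + a))` and is summable in `x`,
so summing over `x` gives `expectedX_le_const`. The comparison fails where the staying coefficient
of the recursion is negative. There `x` is close to `n`, and a faster decaying degree bound takes
over (`degCount_le_profile`).

Lower bound: only leaves attached to a vertex without a loop are counted; their second degree is
exactly `y`. Power laws multiplied by `1 - i / cutoff` are subsolutions, first for `properCount`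
(`le_properCount`), then for `leafCount` (`le_leafCount`). The cutoff is of order `n ^ (1 / (1 +
a))`, the natural scale of the degrees, whence the range of `k`. -/

noncomputable section

namespace BuckleyOsthus

/-! ### Neighbourhoods, and their change when a vertex is added -/

/-- The number of edges sent to the vertex `v`. -/
def indeg {n : ℕ} (g : Graph n) (v : Fin n) : ℕ := ∑ i : Fin n, if target g i = v then 1 else 0

/-- The vertex `v` carries a loop. -/
def isLoop {n : ℕ} (g : Graph n) (v : Fin n) : Bool := decide (target g v = v)

/-- The vertices `u` and `v` are distinct and joined by an edge. -/
def Nbr {n : ℕ} (g : Graph n) (v u : Fin n) : Prop := u ≠ v ∧ (target g v = u ∨ target g u = v)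

instance {n : ℕ} (g : Graph n) (v u : Fin n) : Decidable (Nbr g v u) := by
  unfold Nbr; infer_instance

/-- The sum of the in-degrees of the neighbours of `v`. -/
def nbrWeight {n : ℕ} (g : Graph n) (v : Fin n) : ℕ :=
  ∑ u : Fin n, if Nbr g v u then indeg g u else 0

theorem degree_eq {n : ℕ} (g : Graph n) (v : Fin n) : degree g v = 1 + indeg g v := by
  unfold degree indeg
  rw [Finset.sum_add_distrib]
  simp

theorem sum_indeg {n : ℕ} (g : Graph n) : ∑ v, indeg g v = n := by
  unfold indeg
  rw [Finset.sum_comm]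
  simp

theorem target_le {n : ℕ} (g : Graph n) (v : Fin n) : (target g v).val ≤ v.val := by
  have := (g v).isLt
  simp only [target]; omega

theorem not_nbr_self {n : ℕ} (g : Graph n) (v : Fin n) : ¬ Nbr g v v := by simp [Nbr]

theorem indeg_add_nbrWeight_le {n : ℕ} (g : Graph n) (v : Fin n) :
    indeg g v + nbrWeight g v ≤ n := by
  calc indeg g v + nbrWeight g v
      = ∑ u, ((if u = v then indeg g u else 0) + if Nbr g v u then indeg g u else 0) := by
        rw [Finset.sum_add_distrib]; simp [nbrWeight]
    _ ≤ ∑ u, indeg g u := by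
        refine Finset.sum_le_sum fun u _ => ?_
        by_cases h : u = v
        · subst h; simp [not_nbr_self]
        · simp only [h, if_false, zero_add]; split_ifs <;> omega
    _ = n := sum_indeg g

theorem target_extend_castSucc {n : ℕ} (g : Graph n) (s : Fin (n + 1)) (v : Fin n) :
    target (extend g s) v.castSucc = (target g v).castSucc := by
  ext
  simp only [target, extend, Fin.val_castSucc]
  erw [Fin.snoc_castSucc]

theorem target_extend_last {n : ℕ} (g : Graph n) (s : Fin (n + 1)) :
    target (extend g s) (Fin.last n) = s := by
  ext
  simp only [target, extend]
  erw [Fin.snoc_last]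

theorem indeg_extend_castSucc {n : ℕ} (g : Graph n) (s : Fin (n + 1)) (v : Fin n) :
    indeg (extend g s) v.castSucc = indeg g v + if s = v.castSucc then 1 else 0 := by
  unfold indeg
  rw [Fin.sum_univ_castSucc]
  simp [target_extend_castSucc, target_extend_last]

theorem indeg_extend_last {n : ℕ} (g : Graph n) (s : Fin (n + 1)) :
    indeg (extend g s) (Fin.last n) = if s = Fin.last n then 1 else 0 := by
  unfold indeg
  rw [Fin.sum_univ_castSucc]
  simp [target_extend_castSucc, target_extend_last, (Fin.castSucc_lt_last _).ne]

theorem isLoop_extend_castSucc {n : ℕ} (g : Graph n) (s : Fin (n + 1)) (v : Fin n) :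
    isLoop (extend g s) v.castSucc = isLoop g v := by
  simp [isLoop, target_extend_castSucc]

theorem isLoop_extend_last {n : ℕ} (g : Graph n) (s : Fin (n + 1)) :
    isLoop (extend g s) (Fin.last n) = decide (s = Fin.last n) := by
  simp [isLoop, target_extend_last]

theorem nbr_extend_castSucc {n : ℕ} (g : Graph n) (s : Fin (n + 1)) (v u : Fin n) :
    Nbr (extend g s) v.castSucc u.castSucc ↔ Nbr g v u := by
  simp [Nbr, target_extend_castSucc]

theorem nbr_extend_castSucc_last {n : ℕ} (g : Graph n) (s : Fin (n + 1)) (v : Fin n) :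
    Nbr (extend g s) v.castSucc (Fin.last n) ↔ s = v.castSucc := by
  simp [Nbr, target_extend_castSucc, target_extend_last, (Fin.castSucc_lt_last _).ne,
    (Fin.castSucc_lt_last _).ne']

theorem nbr_extend_last_castSucc {n : ℕ} (g : Graph n) (s : Fin (n + 1)) (u : Fin n) :
    Nbr (extend g s) (Fin.last n) u.castSucc ↔ s = u.castSucc := by
  simp [Nbr, target_extend_castSucc, target_extend_last, (Fin.castSucc_lt_last _).ne]

/-- A new vertex attached to `v` itself becomes a neighbour of in-degree 0, so it adds no weight;
only attachment to a neighbour does. -/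
theorem nbrWeight_extend_castSucc {n : ℕ} (g : Graph n) (s : Fin (n + 1)) (v : Fin n) :
    nbrWeight (extend g s) v.castSucc =
      nbrWeight g v + ∑ u, if Nbr g v u ∧ s = u.castSucc then 1 else 0 := by
  unfold nbrWeight
  rw [Fin.sum_univ_castSucc, ← Finset.sum_add_distrib]
  simp only [nbr_extend_castSucc, nbr_extend_castSucc_last, indeg_extend_castSucc,
    indeg_extend_last]
  have h : (if s = v.castSucc then (if s = Fin.last n then 1 else 0) else 0) = 0 := by
    by_cases h : s = v.castSucc
    · subst h; simp [(Fin.castSucc_lt_last _).ne]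
    · simp [h]
  rw [h, add_zero]
  refine Finset.sum_congr rfl fun u _ => ?_
  by_cases h1 : Nbr g v u <;> simp [h1]

theorem nbrWeight_extend_last {n : ℕ} (g : Graph n) (s : Fin (n + 1)) :
    nbrWeight (extend g s) (Fin.last n) =
      ∑ u : Fin n, if s = u.castSucc then indeg g u + 1 else 0 := by
  unfold nbrWeight
  rw [Fin.sum_univ_castSucc]
  simp only [nbr_extend_last_castSucc, not_nbr_self, if_false, add_zero, indeg_extend_castSucc]
  refine Finset.sum_congr rfl fun u _ => ?_
  by_cases h1 : s = u.castSucc <;> simp [h1]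

/-- Edges point to vertices of no larger label, so the target of `v` never points back unless it is
`v`, and no neighbour is counted twice. A loop removes the target and also one unit of in-degree
that is no neighbour. -/
theorem card_nbr {n : ℕ} (g : Graph n) (v : Fin n) :
    (∑ u : Fin n, if Nbr g v u then (1 : ℝ) else 0) =
      indeg g v + if isLoop g v then -1 else 1 := by
  have key : ∀ u : Fin n, (if Nbr g v u then (1 : ℝ) else 0) =
      (if target g u = v then 1 else 0) +
        (if u = v then (if target g v = v then -1 else 0) else 0) +
        (if u = target g v then (if target g v = v then 0 else 1) else 0) := by
    intro u
    unfold Nbr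
    by_cases h1 : u = v
    · subst h1
      by_cases h2 : target g u = u
      · simp [h2]
      · simp [h2, Ne.symm h2]
    · by_cases h2 : u = target g v
      · have h3 : target g u ≠ v := by
          intro h3
          have e1 := target_le g v
          have e2 := target_le g u
          rw [h3] at e2
          rw [← h2] at e1
          exact h1 (Fin.ext (le_antisymm e1 e2))
        simp [h1, h3, ← h2]
      · simp [h1, h2, Ne.symm h2]
  rw [Finset.sum_congr rfl fun u _ => key u, Finset.sum_add_distrib, Finset.sum_add_distrib]
  simp only [Finset.sum_ite_eq', Finset.mem_univ, if_true, isLoop, indeg, decide_eq_true_eq]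
  push_cast
  split_ifs <;> ring

-- Put `p = target g t` and suppose `t` has no loop. The edge of `t` points to the neighbour `p`, so
-- it counts in `nbrWeight` but not in the second degree. The edge of `p` counts in the second
-- degree, and in `nbrWeight` only if it is a loop. All other edges agree, so the two exceptions
-- cancel unless `p` carries a loop.
open Classical in
theorem secondDegree_eq_sum {n : ℕ} (g : Graph n) (t : Fin n) :
    secondDegree g t + (if isLoop g t = false ∧ isLoop g (target g t) = true then 1 else 0) =
      nbrWeight g t := by
  have hE : ∀ u, u ≠ t → (HasEdge g u t ↔ Nbr g t u) := by
    intro u hu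
    unfold HasEdge Nbr edge
    constructor
    · rintro ⟨i, hi⟩
      rw [Sym2.eq_iff] at hi
      rcases hi with ⟨h1, h2⟩ | ⟨h1, h2⟩
      · subst h1; exact ⟨hu, Or.inr h2⟩
      · subst h1; exact ⟨hu, Or.inl h2⟩
    · rintro ⟨_, h | h⟩
      · exact ⟨t, by rw [h, Sym2.eq_swap]⟩
      · exact ⟨u, by rw [h]⟩
  have hmem : ∀ e, (t ∉ edge g e ∧ ∃ u ∈ edge g e, u ≠ t ∧ HasEdge g u t) ↔
      (e ≠ t ∧ target g e ≠ t ∧ (Nbr g t e ∨ Nbr g t (target g e))) := by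
    intro e
    simp only [edge, Sym2.mem_iff, not_or]
    constructor
    · rintro ⟨⟨h1, h2⟩, u, hu | hu, h3, h4⟩
      · subst hu; exact ⟨h3, Ne.symm h2, Or.inl ((hE _ h3).1 h4)⟩
      · subst hu; exact ⟨Ne.symm h1, h3, Or.inr ((hE _ h3).1 h4)⟩
    · rintro ⟨h1, h2, h3 | h3⟩
      · exact ⟨⟨Ne.symm h1, Ne.symm h2⟩, e, Or.inl rfl, h1, (hE _ h1).2 h3⟩
      · exact ⟨⟨Ne.symm h1, Ne.symm h2⟩, _, Or.inr rfl, h2, (hE _ h2).2 h3⟩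
  have hW : nbrWeight g t = ∑ e, if Nbr g t (target g e) then 1 else 0 := by
    unfold nbrWeight indeg
    have : ∀ u, (if Nbr g t u then ∑ i, (if target g i = u then 1 else 0) else 0) =
        ∑ i, if target g i = u then (if Nbr g t (target g i) then 1 else 0) else 0 := by
      intro u
      by_cases h : Nbr g t u
      · simp only [h, if_true]
        refine Finset.sum_congr rfl fun i _ => ?_
        by_cases h2 : target g i = u
        · subst h2; simp [h]
        · simp [h2]
      · simp only [h, if_false]
        symm
        refine Finset.sum_eq_zero fun i _ => ?_
        by_cases h2 : target g i = u
        · subst h2; simp [h]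
        · simp [h2]
    rw [Finset.sum_congr rfl fun u _ => this u, Finset.sum_comm]
    simp
  have hS : secondDegree g t = ∑ e, if e ≠ t ∧ target g e ≠ t ∧
      (Nbr g t e ∨ Nbr g t (target g e)) then 1 else 0 := by
    unfold secondDegree
    rw [Finset.card_filter]
    refine Finset.sum_congr rfl fun e _ => ?_
    simp only [hmem e]
  rw [hW, hS]
  by_cases hl : target g t = t
  · simp only [isLoop, hl, decide_true]
    simp only [Bool.true_eq_false, false_and, if_false, add_zero]
    refine Finset.sum_congr rfl fun e _ => ?_
    congr 1
    rw [eq_iff_iff]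
    simp only [Nbr, hl]
    constructor
    · rintro ⟨h1, h2, h3 | h3⟩
      · rcases h3 with ⟨_, h3 | h3⟩
        · exact absurd h3.symm h1
        · exact absurd h3 h2
      · exact h3
    · rintro ⟨h1, h2⟩
      refine ⟨?_, h1, Or.inr ⟨h1, h2⟩⟩
      rintro rfl
      exact h1 hl
  · set p := target g t with hp
    have hlt : p < t := lt_of_le_of_ne (target_le g t) hl
    have hpt : target g p < t := lt_of_le_of_lt (target_le g p) hlt
    have key : ∀ e, (if e ≠ t ∧ target g e ≠ t ∧
        (Nbr g t e ∨ Nbr g t (target g e)) then 1 else 0) + (if e = t then 1 else 0) =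
        (if Nbr g t (target g e) then 1 else 0) +
          (if e = p then (if target g p = p then 0 else 1) else 0) := by
      intro e
      have hNt : Nbr g t p := ⟨hl, Or.inl rfl⟩
      by_cases h1 : e = t
      · subst h1
        simp [← hp, hNt, Ne.symm hl]
      · by_cases h2 : e = p
        · subst h2
          by_cases h3 : target g p = p
          · simp [h1, h3, hNt]
          · have : ¬ Nbr g t (target g p) := by
              rintro ⟨_, h4 | h4⟩
              · exact h3 h4.symm
              · have := target_le g (target g p)
                rw [h4] at this
                exact absurd (Fin.lt_def.1 hpt) (by omega)
            simp [h1, h3, hNt, this, hpt.ne]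
        · have h3 : target g e ≠ t → ¬ Nbr g t e := by
            rintro h3 ⟨_, h4 | h4⟩
            · exact h2 h4.symm
            · exact h3 h4
          by_cases h4 : target g e = t
          · simp [h1, h2, h4, not_nbr_self]
          · simp [h1, h2, h4, h3 h4]
    have hs := Finset.sum_congr (rfl : (Finset.univ : Finset (Fin n)) = Finset.univ)
      fun e _ => key e
    rw [Finset.sum_add_distrib, Finset.sum_add_distrib] at hs
    simp only [Finset.sum_ite_eq', Finset.mem_univ, if_true] at hs
    have h6 : isLoop g t = false := by simp [isLoop, ← hp, hl]
    by_cases h5 : target g p = p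
    · have : isLoop g p = true := by simp [isLoop, h5]
      simp only [h6, this, and_self, if_true]
      simpa [h5] using hs
    · have : isLoop g p = false := by simp [isLoop, h5]
      simp only [h6, this]
      simp only [h5, if_false] at hs
      simp only [Bool.false_eq_true, and_false, if_false, add_zero]
      exact Nat.add_right_cancel hs

/-! ### Expectations and the one-step evolution of sums over vertices -/

/-- The expectation of a function of the random graph on `n` vertices. -/
def expect {a : ℝ} (ha : 0 < a) (n : ℕ) (F : Graph n → ℝ) : ℝ :=
  ∑ g : Graph n, (law ha n g).toReal * F g

/-- The denominator of the attachment probabilities of the vertex number `n + 1`. -/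
def den (a : ℝ) (n : ℕ) : ℝ := (a + 1) * ((n : ℝ) + 1) - 1

theorem den_pos' {a : ℝ} (ha : 0 < a) (n : ℕ) : 0 < den a n := den_pos ha n

theorem den_succ (a : ℝ) (n : ℕ) : den a (n + 1) = den a n + a + 1 := by
  unfold den; push_cast; ring

theorem den_eq (a : ℝ) (n : ℕ) : den a n = (a + 1) * n + a := by
  unfold den; ring

variable {a : ℝ} (ha : 0 < a)

include ha in
theorem expect_succ (n : ℕ) (F : Graph (n + 1) → ℝ) :
    expect ha (n + 1) F = expect ha n fun g => ∑ s, stepProb a g s * F (extend g s) := by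
  have hlaw : ∀ h : Graph (n + 1), (law ha (n + 1) h).toReal =
      ∑ g, (law ha n g).toReal * ∑ s, if h = extend g s then stepProb a g s else 0 := by
    intro h
    rw [law, PMF.bind_apply, tsum_fintype, ENNReal.toReal_sum]
    · refine Finset.sum_congr rfl fun g _ => ?_
      rw [ENNReal.toReal_mul, PMF.map_apply, tsum_fintype, ENNReal.toReal_sum]
      · congr 1
        refine Finset.sum_congr rfl fun s _ => ?_
        split_ifs
        · simp [step, PMF.ofFintype_apply, ENNReal.toReal_ofReal (stepProb_nonneg ha g s)]
        · simp
      · intro s _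
        split_ifs
        · exact PMF.apply_ne_top _ _
        · simp
    · intro g _
      exact ENNReal.mul_ne_top (PMF.apply_ne_top _ _) (PMF.apply_ne_top _ _)
  unfold expect
  simp_rw [hlaw, Finset.sum_mul]
  rw [Finset.sum_comm]
  refine Finset.sum_congr rfl fun g _ => ?_
  simp_rw [mul_assoc, Finset.sum_mul, ← Finset.mul_sum]
  rw [Finset.sum_comm]
  congr 1
  refine Finset.sum_congr rfl fun s _ => ?_
  simp [ite_mul]

theorem expect_add (n : ℕ) (F G : Graph n → ℝ) :
    expect ha n (fun g => F g + G g) = expect ha n F + expect ha n G := by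
  simp [expect, mul_add, Finset.sum_add_distrib]

theorem expect_mul_const (n : ℕ) (F : Graph n → ℝ) (c : ℝ) :
    expect ha n (fun g => F g * c) = expect ha n F * c := by
  simp [expect, Finset.sum_mul, mul_assoc]

theorem expect_sum {ι : Type*} (s : Finset ι) (n : ℕ) (F : ι → Graph n → ℝ) :
    expect ha n (fun g => ∑ i ∈ s, F i g) = ∑ i ∈ s, expect ha n (F i) := by
  simp only [expect, Finset.mul_sum]
  exact Finset.sum_comm

theorem expect_mono (n : ℕ) {F G : Graph n → ℝ} (h : ∀ g, F g ≤ G g) :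
    expect ha n F ≤ expect ha n G :=
  Finset.sum_le_sum fun g _ => mul_le_mul_of_nonneg_left (h g) ENNReal.toReal_nonneg

theorem expect_const (n : ℕ) (c : ℝ) : expect ha n (fun _ => c) = c := by
  have h : ∑ g, (law ha n g).toReal = 1 := by
    rw [← ENNReal.toReal_sum fun g _ => PMF.apply_ne_top _ _, ← tsum_fintype (L := .unconditional _),
      PMF.tsum_coe, ENNReal.toReal_one]
  simp [expect, ← Finset.sum_mul, h]

/-- The sum over all vertices of a function of the presence of a loop at the vertex, of the presence
of a loop at the target of its edge, of its in-degree and of the weight of its neighbourhood. -/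
def vertexSum (φ : Bool → Bool → ℝ → ℝ → ℝ) {n : ℕ} (g : Graph n) : ℝ :=
  ∑ v, φ (isLoop g v) (isLoop g (target g v)) (indeg g v) (nbrWeight g v)

/-- The number of neighbours minus the in-degree. -/
def shift (l : Bool) : ℝ := if l then -1 else 1

theorem stepProb_castSucc {n : ℕ} (g : Graph n) (u : Fin n) :
    stepProb a g u.castSucc = (indeg g u + a) / den a n := by
  simp [stepProb, degree_eq, den]

theorem stepProb_last {n : ℕ} (g : Graph n) : stepProb a g (Fin.last n) = a / den a n := by
  simp [stepProb, den]

-- The events that the new edge hits `v`, hits a neighbour of `v`, or neither are disjoint, so at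
-- most one coordinate moves, and by one. The neighbours have total attractiveness `nbrWeight + a *
-- (number of neighbours)`.
include ha in
theorem step_vertex {n : ℕ} (g : Graph n) (v : Fin n) (ψ : ℝ → ℝ → ℝ) :
    ∑ s, stepProb a g s * ψ (indeg (extend g s) v.castSucc) (nbrWeight (extend g s) v.castSucc) =
      ψ (indeg g v) (nbrWeight g v) * (1 - (indeg g v + a) / den a n -
        (nbrWeight g v + a * (indeg g v + shift (isLoop g v))) / den a n) +
      ψ (indeg g v + 1) (nbrWeight g v) * ((indeg g v + a) / den a n) +
      ψ (indeg g v) (nbrWeight g v + 1) *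
        ((nbrWeight g v + a * (indeg g v + shift (isLoop g v))) / den a n) := by
  set A := ψ (indeg g v) (nbrWeight g v)
  set B := ψ (indeg g v + 1) (nbrWeight g v)
  set C := ψ (indeg g v) (nbrWeight g v + 1)
  have key : ∀ s, ψ (indeg (extend g s) v.castSucc) (nbrWeight (extend g s) v.castSucc) =
      A + (if s = v.castSucc then 1 else 0) * (B - A) +
        (∑ u, if Nbr g v u ∧ s = u.castSucc then 1 else 0) * (C - A) := by
    intro s
    rw [indeg_extend_castSucc, nbrWeight_extend_castSucc]
    by_cases h1 : s = v.castSucc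
    · have h2 : ∀ u, ¬ (Nbr g v u ∧ s = u.castSucc) := by
        rintro u ⟨h2, h3⟩
        rw [h1] at h3
        exact h2.1 (Fin.castSucc_injective _ h3).symm
      simp only [h2, if_false, Finset.sum_const_zero]
      simp [h1, A, B]
    · by_cases h2 : ∃ u, Nbr g v u ∧ s = u.castSucc
      · obtain ⟨w, hw, rfl⟩ := h2
        have h3 : ∀ u, (Nbr g v u ∧ w.castSucc = u.castSucc) ↔ u = w := by
          intro u
          constructor
          · rintro ⟨_, h⟩; exact (Fin.castSucc_injective _ h).symm
          · rintro rfl; exact ⟨hw, rfl⟩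
        simp only [h3, Finset.sum_ite_eq', Finset.mem_univ, if_true]
        simp [h1, A, C]
      · push Not at h2
        have h3 : ∀ u, ¬ (Nbr g v u ∧ s = u.castSucc) := fun u h => h2 u h.1 h.2
        simp only [h3, if_false, Finset.sum_const_zero]
        simp [h1, A]
  simp_rw [key, mul_add, Finset.sum_add_distrib, ← mul_assoc, ← Finset.sum_mul]
  rw [sum_stepProb ha g]
  have e1 : ∑ s, stepProb a g s * (if s = v.castSucc then 1 else 0) =
      (indeg g v + a) / den a n := by
    simp [stepProb_castSucc]
  have e2 : ∑ s, stepProb a g s * (∑ u, if Nbr g v u ∧ s = u.castSucc then (1 : ℝ) else 0) =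
      (nbrWeight g v + a * (indeg g v + shift (isLoop g v))) / den a n := by
    simp_rw [Finset.mul_sum]
    rw [Finset.sum_comm]
    have : ∀ u, ∑ s, stepProb a g s * (if Nbr g v u ∧ s = u.castSucc then (1 : ℝ) else 0) =
        ((if Nbr g v u then (indeg g u : ℝ) else 0) + a * (if Nbr g v u then 1 else 0)) /
          den a n := by
      intro u
      by_cases h : Nbr g v u
      · simp [h, stepProb_castSucc]
      · simp [h]
    rw [Finset.sum_congr rfl fun u _ => this u, ← Finset.sum_div, Finset.sum_add_distrib,
      ← Finset.mul_sum, card_nbr]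
    simp [nbrWeight, shift]
  rw [e1, e2]
  ring

-- Old vertices give the first sum. The other terms are births: a leaf attached to a vertex of
-- in-degree `x` starts with weight `x + 1`, its own edge included; a newborn loop has in-degree 1
-- and weight 0.
include ha in
theorem step_vertexSum (φ : Bool → Bool → ℝ → ℝ → ℝ) {n : ℕ} (g : Graph n) :
    ∑ s, stepProb a g s * vertexSum φ (extend g s) =
      vertexSum (fun l m x y =>
        φ l m x y * (1 - (x + a) / den a n - (y + a * (x + shift l)) / den a n) +
        φ l m (x + 1) y * ((x + a) / den a n) +
        φ l m x (y + 1) * ((y + a * (x + shift l)) / den a n)) g +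
      vertexSum (fun l _ x _ => φ false l 0 (x + 1) * ((x + a) / den a n)) g +
      φ true true 1 0 * (a / den a n) := by
  unfold vertexSum
  simp_rw [Fin.sum_univ_castSucc (n := n) (f := fun v => φ _ _ _ _), mul_add,
    Finset.sum_add_distrib, Finset.mul_sum]
  rw [Finset.sum_comm, add_assoc, ← Finset.sum_add_distrib, ← Finset.sum_add_distrib]
  congr 1
  · refine Finset.sum_congr rfl fun v _ => ?_
    simp_rw [target_extend_castSucc, isLoop_extend_castSucc]
    rw [step_vertex ha g v (φ (isLoop g v) (isLoop g (target g v)))]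
    ring
  · rw [Fin.sum_univ_castSucc]
    congr 1
    · refine Finset.sum_congr rfl fun u _ => ?_
      rw [stepProb_castSucc, target_extend_last, isLoop_extend_last, isLoop_extend_castSucc,
        indeg_extend_last, nbrWeight_extend_last]
      simp [(Fin.castSucc_lt_last _).ne, mul_comm]
    · rw [stepProb_last, target_extend_last, isLoop_extend_last,
        indeg_extend_last, nbrWeight_extend_last]
      simp [(Fin.castSucc_lt_last _).ne', mul_comm]

theorem expect_vertexSum_succ (φ : Bool → Bool → ℝ → ℝ → ℝ) (n : ℕ) :
    expect ha (n + 1) (vertexSum φ) =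
      expect ha n (vertexSum (fun l m x y =>
        φ l m x y * (1 - (x + a) / den a n - (y + a * (x + shift l)) / den a n) +
        φ l m (x + 1) y * ((x + a) / den a n) +
        φ l m x (y + 1) * ((y + a * (x + shift l)) / den a n))) +
      expect ha n (vertexSum (fun l _ x _ => φ false l 0 (x + 1) * ((x + a) / den a n))) +
      φ true true 1 0 * (a / den a n) := by
  rw [expect_succ]
  simp_rw [step_vertexSum ha]
  rw [expect_add, expect_add, expect_const]

theorem expect_vertexSum_add (n : ℕ) (φ ψ : Bool → Bool → ℝ → ℝ → ℝ) :
    expect ha n (vertexSum fun l m x y => φ l m x y + ψ l m x y) =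
      expect ha n (vertexSum φ) + expect ha n (vertexSum ψ) := by
  rw [← expect_add]
  congr 1
  funext g
  simp only [vertexSum, Finset.sum_add_distrib]

theorem expect_vertexSum_mul_const (n : ℕ) (φ : Bool → Bool → ℝ → ℝ → ℝ) (c : ℝ) :
    expect ha n (vertexSum fun l m x y => φ l m x y * c) = expect ha n (vertexSum φ) * c := by
  rw [← expect_mul_const]
  congr 1
  funext g
  simp only [vertexSum, Finset.sum_mul]

theorem expect_vertexSum_congr (n : ℕ) {φ ψ : Bool → Bool → ℝ → ℝ → ℝ}
    (h : ∀ l m (i j : ℕ), φ l m i j = ψ l m i j) :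
    expect ha n (vertexSum φ) = expect ha n (vertexSum ψ) := by
  congr 1
  funext g
  exact Finset.sum_congr rfl fun v _ => h _ _ _ _

theorem expect_vertexSum_mono (n : ℕ) {φ ψ : Bool → Bool → ℝ → ℝ → ℝ}
    (h : ∀ l m (i j : ℕ), φ l m i j ≤ ψ l m i j) :
    expect ha n (vertexSum φ) ≤ expect ha n (vertexSum ψ) :=
  expect_mono ha n fun _ => Finset.sum_le_sum fun _ _ => h _ _ _ _

theorem expect_vertexSum_eq_zero (n : ℕ) {φ : Bool → Bool → ℝ → ℝ → ℝ}
    (h : ∀ (g : Graph n) (v : Fin n),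
      φ (isLoop g v) (isLoop g (target g v)) (indeg g v) (nbrWeight g v) = 0) :
    expect ha n (vertexSum φ) = 0 := by
  have : vertexSum φ = fun _ : Graph n => (0 : ℝ) := by
    funext g
    exact Finset.sum_eq_zero fun v _ => h g v
  rw [this, expect_const]

theorem expect_vertexSum_zero (φ : Bool → Bool → ℝ → ℝ → ℝ) :
    expect ha 0 (vertexSum φ) = 0 :=
  expect_vertexSum_eq_zero ha 0 fun _ v => v.elim0

theorem expect_vertexSum_nonneg (n : ℕ) {φ : Bool → Bool → ℝ → ℝ → ℝ}
    (h : ∀ l m x y, 0 ≤ φ l m x y) : 0 ≤ expect ha n (vertexSum φ) :=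
  Finset.sum_nonneg fun _ _ => mul_nonneg ENNReal.toReal_nonneg
    (Finset.sum_nonneg fun _ _ => h _ _ _ _)

include ha in
theorem expect_attach (n : ℕ) :
    expect ha n (vertexSum fun _ _ x _ => (x + a) / den a n) = 1 - a / den a n := by
  have : vertexSum (fun _ _ x _ => (x + a) / den a n) =
      fun _ : Graph n => 1 - a / den a n := by
    funext g
    have h := sum_indeg g
    have h2 : ∑ v, (indeg g v : ℝ) = n := by exact_mod_cast h
    have hd := (den_pos' ha n).ne'
    simp only [vertexSum]
    rw [← Finset.sum_div, Finset.sum_add_distrib, h2]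
    simp only [Finset.sum_const, Finset.card_univ, Fintype.card_fin, nsmul_eq_mul]
    field_simp
    rw [den_eq]; ring
  rw [this, expect_const]

/-! ### Expected counts by type, their supports and their recursions -/

/-- The expected number of vertices of in-degree `x`. -/
def degCount (n : ℕ) (x : ℝ) : ℝ :=
  expect ha n (vertexSum fun _ _ i _ => if i = x then 1 else 0)

/-- The expected number of vertices of in-degree `x` without a loop. -/
def properCount (n : ℕ) (x : ℝ) : ℝ :=
  expect ha n (vertexSum fun l _ i _ => if l = false ∧ i = x then 1 else 0)

/-- The expected number of vertices with given presence of a loop, in-degree and weight of the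
neighbourhood. -/
def classCount (l : Bool) (n : ℕ) (x y : ℝ) : ℝ :=
  expect ha n (vertexSum fun l' _ i j => if l' = l ∧ i = x ∧ j = y then 1 else 0)

/-- The expected number of leaves which are attached to a vertex without a loop and whose
neighbourhood has weight `y`. -/
def leafCount (n : ℕ) (y : ℝ) : ℝ :=
  expect ha n (vertexSum fun l m i j =>
    if l = false ∧ m = false ∧ i = 0 ∧ j = y then 1 else 0)

theorem classCount_zero (l : Bool) (x y : ℝ) : classCount ha l 0 x y = 0 :=
  expect_vertexSum_zero ha _

theorem properCount_nonneg (n : ℕ) (x : ℝ) : 0 ≤ properCount ha n x :=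
  expect_vertexSum_nonneg ha n fun _ _ _ _ => by split_ifs <;> norm_num

theorem classCount_nonneg (l : Bool) (n : ℕ) (x y : ℝ) : 0 ≤ classCount ha l n x y :=
  expect_vertexSum_nonneg ha n fun _ _ _ _ => by split_ifs <;> norm_num

theorem leafCount_nonneg (n : ℕ) (y : ℝ) : 0 ≤ leafCount ha n y :=
  expect_vertexSum_nonneg ha n fun _ _ _ _ => by split_ifs <;> norm_num

theorem classCount_le_degCount (l : Bool) (n : ℕ) (x y : ℝ) :
    classCount ha l n x y ≤ degCount ha n x :=
  expect_vertexSum_mono ha n fun l' _ i j => by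
    by_cases h1 : (i : ℝ) = x
    · simp only [h1, if_true, true_and]; split_ifs <;> norm_num
    · simp [h1]

theorem degCount_of_neg (n : ℕ) {x : ℝ} (hx : x < 0) : degCount ha n x = 0 :=
  expect_vertexSum_eq_zero ha n fun g v => by
    have : (0 : ℝ) ≤ indeg g v := Nat.cast_nonneg _
    rw [if_neg]; intro h; linarith

theorem properCount_of_neg (n : ℕ) {x : ℝ} (hx : x < 0) : properCount ha n x = 0 :=
  expect_vertexSum_eq_zero ha n fun g v => by
    have : (0 : ℝ) ≤ indeg g v := Nat.cast_nonneg _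
    rw [if_neg]; intro h; linarith [h.2]

theorem classCount_of_neg_left (l : Bool) (n : ℕ) {x : ℝ} (hx : x < 0) (y : ℝ) :
    classCount ha l n x y = 0 :=
  expect_vertexSum_eq_zero ha n fun g v => by
    have : (0 : ℝ) ≤ indeg g v := Nat.cast_nonneg _
    rw [if_neg]; intro h; linarith [h.2.1]

theorem classCount_of_neg_right (l : Bool) (n : ℕ) (x : ℝ) {y : ℝ} (hy : y < 0) :
    classCount ha l n x y = 0 :=
  expect_vertexSum_eq_zero ha n fun g v => by
    have : (0 : ℝ) ≤ nbrWeight g v := Nat.cast_nonneg _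
    rw [if_neg]; intro h; linarith [h.2.2]

theorem classCount_of_lt (l : Bool) (n : ℕ) {x y : ℝ} (h : (n : ℝ) < x + y) :
    classCount ha l n x y = 0 :=
  expect_vertexSum_eq_zero ha n fun g v => by
    have : (indeg g v : ℝ) + nbrWeight g v ≤ n := by exact_mod_cast indeg_add_nbrWeight_le g v
    rw [if_neg]; intro h'; linarith [h'.2.1, h'.2.2]

/-- A loop contributes to the in-degree of its own vertex, so a negative number of neighbours never
occurs. -/
theorem classCount_of_shift (l : Bool) (n : ℕ) {x : ℝ} (hx : x + shift l < 0) (y : ℝ) :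
    classCount ha l n x y = 0 :=
  expect_vertexSum_eq_zero ha n fun g v => by
    have h0 : (0 : ℝ) ≤ indeg g v := Nat.cast_nonneg _
    rw [if_neg]
    rintro ⟨h1, h2, -⟩
    cases l
    · simp only [shift, Bool.false_eq_true, if_false] at hx
      linarith
    · have h3 : target g v = v := by simpa [isLoop] using h1
      have h4 : 1 ≤ indeg g v := by
        unfold indeg
        refine le_trans ?_ (Finset.single_le_sum (fun i _ => Nat.zero_le _) (Finset.mem_univ v))
        simp [h3]
      have h5 : (1 : ℝ) ≤ indeg g v := by exact_mod_cast h4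
      simp only [shift, if_true] at hx
      linarith

/-- Real arguments avoid truncated subtraction: at the boundary, `x - 1` is negative and its count
vanishes. The sources are the newborn vertices without a loop (`x = 0`) and with one (`x = 1`). -/
theorem degCount_succ (n : ℕ) (x : ℝ) :
    degCount ha (n + 1) x = degCount ha n x * (1 - (x + a) / den a n) +
      degCount ha n (x - 1) * ((x - 1 + a) / den a n) +
      (if x = 0 then 1 - a / den a n else 0) + (if x = 1 then a / den a n else 0) := by
  unfold degCount
  rw [expect_vertexSum_succ]
  congr 1
  · congr 1
    · rw [← expect_vertexSum_mul_const, ← expect_vertexSum_mul_const, ← expect_vertexSum_add]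
      refine expect_vertexSum_congr ha n fun l m i j => ?_
      by_cases h1 : (i : ℝ) = x
      · have h2 : x + 1 ≠ x := by linarith
        have h3 : x ≠ x - 1 := by linarith
        simp only [h1, h2, h3, if_true, if_false]; ring
      · by_cases h2 : (i : ℝ) + 1 = x
        · have h3 : (i : ℝ) = x - 1 := by linarith
          simp [h3]
        · have h3 : (i : ℝ) ≠ x - 1 := fun h => h2 (by linarith)
          simp [h1, h2, h3]
    · by_cases h : x = 0
      · subst h
        simp only [if_true, one_mul]
        exact expect_attach ha n
      · simp only [Ne.symm h, h, if_false, zero_mul]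
        exact expect_vertexSum_eq_zero ha n fun _ _ => rfl
  · simp [eq_comm]

theorem properCount_succ (n : ℕ) (x : ℝ) :
    properCount ha (n + 1) x = properCount ha n x * (1 - (x + a) / den a n) +
      properCount ha n (x - 1) * ((x - 1 + a) / den a n) +
      (if x = 0 then 1 - a / den a n else 0) := by
  unfold properCount
  rw [expect_vertexSum_succ]
  simp only [Bool.true_eq_false, false_and, if_false, zero_mul, add_zero]
  congr 1
  · rw [← expect_vertexSum_mul_const, ← expect_vertexSum_mul_const, ← expect_vertexSum_add]
    refine expect_vertexSum_congr ha n fun l m i j => ?_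
    cases l
    · by_cases h1 : (i : ℝ) = x
      · have h2 : x + 1 ≠ x := by linarith
        have h3 : x ≠ x - 1 := by linarith
        simp only [h1, h2, h3, and_false, and_true, if_true, if_false]; ring
      · by_cases h2 : (i : ℝ) + 1 = x
        · have h3 : (i : ℝ) = x - 1 := by linarith
          simp [h3]
        · have h3 : (i : ℝ) ≠ x - 1 := fun h => h2 (by linarith)
          simp [h1, h2, h3]
    · simp
  · by_cases h : x = 0
    · subst h
      simp only [and_self, if_true, one_mul]
      exact expect_attach ha n
    · simp only [Ne.symm h, h, and_false, if_false, zero_mul]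
      exact expect_vertexSum_eq_zero ha n fun _ _ => rfl

theorem classCount_succ (l : Bool) (n : ℕ) (x y : ℝ) :
    classCount ha l (n + 1) x y =
      classCount ha l n x y * (1 - (x + a) / den a n - (y + a * (x + shift l)) / den a n) +
      classCount ha l n (x - 1) y * ((x - 1 + a) / den a n) +
      classCount ha l n x (y - 1) * ((y - 1 + a * (x + shift l)) / den a n) +
      (if l = false ∧ x = 0 then degCount ha n (y - 1) * ((y - 1 + a) / den a n) else 0) +
      (if l = true ∧ x = 1 ∧ y = 0 then a / den a n else 0) := by
  unfold classCount
  rw [expect_vertexSum_succ]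
  congr 1
  · congr 1
    · simp only [← expect_vertexSum_mul_const, ← expect_vertexSum_add]
      refine expect_vertexSum_congr ha n fun l' m i j => ?_
      by_cases hl : l' = l
      · subst hl
        by_cases h1 : (i : ℝ) = x
        · have h2 : x + 1 ≠ x := by linarith
          have h3 : x ≠ x - 1 := by linarith
          by_cases h4 : (j : ℝ) = y
          · have h5 : y + 1 ≠ y := by linarith
            have h6 : y ≠ y - 1 := by linarith
            simp only [h1, h2, h3, h4, h5, h6, false_and, and_false, and_self, if_true, if_false]
            ring
          · by_cases h5 : (j : ℝ) + 1 = y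
            · have h6 : (j : ℝ) = y - 1 := by linarith
              simp [h1, h6, h2, h3]
            · have h6 : (j : ℝ) ≠ y - 1 := fun h => h5 (by linarith)
              simp [h4, h5, h6]
        · by_cases h2 : (i : ℝ) + 1 = x
          · have h3 : (i : ℝ) = x - 1 := by linarith
            by_cases h4 : (j : ℝ) = y
            · simp [h3, h4]
            · simp [h3, h4]
          · have h3 : (i : ℝ) ≠ x - 1 := fun h => h2 (by linarith)
            simp [h1, h2, h3]
      · simp [hl]
    · by_cases h : l = false ∧ x = 0
      · obtain ⟨rfl, rfl⟩ := h
        simp only [true_and, and_self, if_true]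
        unfold degCount
        rw [← expect_vertexSum_mul_const]
        refine expect_vertexSum_congr ha n fun l' m i j => ?_
        by_cases h2 : (i : ℝ) + 1 = y
        · have h3 : (i : ℝ) = y - 1 := by linarith
          simp [h3]
        · have h3 : (i : ℝ) ≠ y - 1 := fun h => h2 (by linarith)
          simp [h2, h3]
      · rw [if_neg h]
        refine expect_vertexSum_eq_zero ha n fun _ _ => ?_
        rw [if_neg, zero_mul]
        rintro ⟨h1, h2, -⟩
        exact h ⟨h1.symm, h2.symm⟩
  · simp [eq_comm]

/-- A leaf has a single neighbour, so its weight grows at rate `y + a`; it stops being a leaf at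
rate `a`. -/
theorem leafCount_succ (n : ℕ) (y : ℝ) :
    leafCount ha (n + 1) y = leafCount ha n y * (1 - (y + 2 * a) / den a n) +
      leafCount ha n (y - 1) * ((y - 1 + a) / den a n) +
      properCount ha n (y - 1) * ((y - 1 + a) / den a n) := by
  unfold leafCount properCount
  rw [expect_vertexSum_succ]
  simp only [Bool.true_eq_false, false_and, if_false, zero_mul, add_zero]
  congr 1
  · simp only [← expect_vertexSum_mul_const, ← expect_vertexSum_add]
    refine expect_vertexSum_congr ha n fun l m i j => ?_
    have h0 : (i : ℝ) + 1 ≠ 0 := by positivity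
    cases l
    · cases m
      · by_cases h1 : (i : ℝ) = 0
        · by_cases h4 : (j : ℝ) = y
          · have h5 : y + 1 ≠ y := by linarith
            have h6 : y ≠ y - 1 := by linarith
            simp only [h1, h4, h5, h6, and_false, and_self, if_true, if_false, shift,
              Bool.false_eq_true, zero_add, one_ne_zero, false_and]
            ring
          · by_cases h5 : (j : ℝ) + 1 = y
            · have h6 : (j : ℝ) = y - 1 := by linarith
              simp [h1, h6, shift]
            · have h6 : (j : ℝ) ≠ y - 1 := fun h => h5 (by linarith)
              simp [h4, h5, h6]
        · simp only [h1, h0, false_and, and_false, if_false, zero_mul, add_zero]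
      · simp
    · simp
  · rw [← expect_vertexSum_mul_const]
    refine expect_vertexSum_congr ha n fun l m i j => ?_
    by_cases h2 : (i : ℝ) + 1 = y
    · have h3 : (i : ℝ) = y - 1 := by linarith
      simp [h3]
    · have h3 : (i : ℝ) ≠ y - 1 := fun h => h2 (by linarith)
      simp [h2, h3]

/-! ### Comparison of the second degree counts with the type counts -/

theorem expectedX_eq (n k : ℕ) : expectedX ha n k = expect ha n fun g => (X g k : ℝ) := rfl

theorem cast_X {n : ℕ} (g : Graph n) (k : ℕ) :
    (X g k : ℝ) = ∑ t, if secondDegree g t = k then (1 : ℝ) else 0 := by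
  rw [X, Finset.card_filter]
  push_cast
  exact Finset.sum_congr rfl fun _ _ => by congr

theorem leafCount_le_expectedX (n k : ℕ) : leafCount ha n k ≤ expectedX ha n k := by
  rw [expectedX_eq]
  refine expect_mono ha n fun g => ?_
  rw [cast_X]
  refine Finset.sum_le_sum fun t _ => ?_
  beta_reduce
  by_cases h : isLoop g t = false ∧ isLoop g (target g t) = false ∧ (indeg g t : ℝ) = 0 ∧
      (nbrWeight g t : ℝ) = k
  · have h1 := secondDegree_eq_sum g t
    simp only [h.1, h.2.1, Bool.false_eq_true, and_false, if_false, add_zero] at h1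
    have h2 : nbrWeight g t = k := by exact_mod_cast h.2.2.2
    rw [if_pos h, if_pos (h1.trans h2)]
  · rw [if_neg h]
    split_ifs <;> norm_num

theorem expectedX_le (n k : ℕ) : expectedX ha n k ≤
    ∑ l : Bool, ∑ i ∈ Finset.range (n + 1),
      (classCount ha l n i k + classCount ha l n i (k + 1)) := by
  rw [expectedX_eq]
  unfold classCount
  simp_rw [← expect_add, ← expect_sum]
  refine expect_mono ha n fun g => ?_
  rw [cast_X]
  unfold vertexSum
  simp_rw [← Finset.sum_add_distrib]
  rw [Finset.sum_congr rfl fun l _ => Finset.sum_comm, Finset.sum_comm]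
  refine Finset.sum_le_sum fun t _ => ?_
  have h0 : ∀ (l : Bool) (i : ℕ), (0 : ℝ) ≤
      (if isLoop g t = l ∧ (indeg g t : ℝ) = i ∧ (nbrWeight g t : ℝ) = k then 1 else 0) +
      (if isLoop g t = l ∧ (indeg g t : ℝ) = i ∧ (nbrWeight g t : ℝ) = k + 1 then 1 else 0) := by
    intro l i
    split_ifs <;> norm_num
  have hi : indeg g t ∈ Finset.range (n + 1) := by
    have := indeg_add_nbrWeight_le g t
    simp only [Finset.mem_range]; omega
  refine le_trans ?_ (Finset.single_le_sum (fun l _ => Finset.sum_nonneg fun i _ => h0 l i)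
    (Finset.mem_univ (isLoop g t)))
  refine le_trans ?_ (Finset.single_le_sum (fun i _ => h0 _ i) hi)
  by_cases h : secondDegree g t = k
  · have h1 := secondDegree_eq_sum g t
    rw [h] at h1
    split_ifs at h1
    · have h2 : (nbrWeight g t : ℝ) = k + 1 := by rw [← h1]; push_cast; ring
      simp [h, h2]
    · have h2 : (nbrWeight g t : ℝ) = k := by rw [← h1]; push_cast; ring
      simp [h, h2]
  · rw [if_neg h]
    exact h0 _ _

/-! ### Upper bounds for the degree counts -/

/-- Bernoulli's inequality for `(1 - 1 / z) ^ r`. With `z = x + a + θ` and `r = 1 + θ` the factor `z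
- r` is the inflow rate `x - 1 + a`, so the power law is a supersolution in `x`. -/
theorem rpow_neg_sub_one_le {r z : ℝ} (hr : 1 ≤ r) (hz : 1 < z) :
    (z - r) * (z - 1) ^ (-r) ≤ z * z ^ (-r) := by
  have hz0 : 0 < z := by linarith
  have h := one_add_mul_self_le_rpow_one_add (s := -1 / z) (p := r)
    (by rw [le_div_iff₀ hz0]; linarith) hr
  have e : 1 + -1 / z = (z - 1) / z := by field_simp; ring
  rw [e, Real.div_rpow (by linarith) hz0.le] at h
  have h1 : 0 < (z - 1) ^ r := Real.rpow_pos_of_pos (by linarith) _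
  have h2 : 0 < z ^ r := Real.rpow_pos_of_pos hz0 _
  rw [Real.rpow_neg (by linarith), Real.rpow_neg hz0.le, ← div_eq_mul_inv, ← div_eq_mul_inv,
    div_le_div_iff₀ h1 h2]
  have h3 : 1 + r * (-1 / z) = (z - r) / z := by field_simp; ring
  rw [h3, div_le_div_iff₀ hz0 h2] at h
  linarith

/-- The strict form leaves room at `x = 1` for the source of newborn loops. -/
theorem rpow_neg_sub_one_lt {r z : ℝ} (hr : 1 < r) (hz : 1 < z) :
    (z - r) * (z - 1) ^ (-r) < z * z ^ (-r) := by
  have hz0 : 0 < z := by linarith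
  have h := one_add_mul_self_lt_rpow_one_add (s := -1 / z) (p := r)
    (by rw [le_div_iff₀ hz0]; linarith) (by simp [hz0.ne']) hr
  have e : 1 + -1 / z = (z - 1) / z := by field_simp; ring
  rw [e, Real.div_rpow (by linarith) hz0.le] at h
  have h1 : 0 < (z - 1) ^ r := Real.rpow_pos_of_pos (by linarith) _
  have h2 : 0 < z ^ r := Real.rpow_pos_of_pos hz0 _
  rw [Real.rpow_neg (by linarith), Real.rpow_neg hz0.le, ← div_eq_mul_inv, ← div_eq_mul_inv,
    div_lt_div_iff₀ h1 h2]
  have h3 : 1 + r * (-1 / z) = (z - r) / z := by field_simp; ring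
  rw [h3, div_lt_div_iff₀ hz0 h2] at h
  linarith

theorem le_den {a : ℝ} (ha : 0 < a) (n : ℕ) : a ≤ den a n := by
  rw [den_eq]
  have : (0 : ℝ) ≤ n := Nat.cast_nonneg n
  nlinarith [mul_nonneg ha.le this]

theorem degCount_of_lt (n : ℕ) {x : ℝ} (h : (n : ℝ) < x) : degCount ha n x = 0 :=
  expect_vertexSum_eq_zero ha n fun g v => by
    have h1 : (indeg g v : ℝ) ≤ n := by
      exact_mod_cast (Nat.le_add_right _ _).trans (indeg_add_nbrWeight_le g v)
    rw [if_neg]; intro h'; linarith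

theorem degCount_le_self (n : ℕ) (x : ℝ) : degCount ha n x ≤ n := by
  refine le_trans ?_ (expect_const ha n (n : ℝ)).le
  refine expect_mono ha n fun g => ?_
  refine (Finset.sum_le_sum (g := fun _ => (1 : ℝ)) fun v _ => ?_).trans (by simp)
  beta_reduce
  split_ifs <;> norm_num

include ha in
theorem den_rpow_succ {θ : ℝ} (hθ : a + 1 ≤ θ) (n : ℕ) :
    den a n ^ (θ / (a + 1)) * (den a n + θ) ≤ den a n * den a (n + 1) ^ (θ / (a + 1)) := by
  have hD := den_pos' ha n
  have hτ : 1 ≤ θ / (a + 1) := by rw [le_div_iff₀ (by linarith)]; linarith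
  have h := one_add_mul_self_le_rpow_one_add (s := (a + 1) / den a n) (p := θ / (a + 1))
    (by have : 0 ≤ (a + 1) / den a n := by positivity
        linarith) hτ
  have e1 : θ / (a + 1) * ((a + 1) / den a n) = θ / den a n := by field_simp
  have e2 : 1 + (a + 1) / den a n = den a (n + 1) / den a n := by
    rw [den_succ]; field_simp; ring
  rw [e1, e2, Real.div_rpow (den_pos' ha _).le hD.le,
    le_div_iff₀ (Real.rpow_pos_of_pos hD _)] at h
  have h2 := mul_le_mul_of_nonneg_left h hD.le
  refine le_trans (le_of_eq ?_) h2
  field_simp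

/-- The value `θ = a + 1` gives linear growth and the true power law. Larger `θ` trades growth in
`n` for decay in `x`, which pays when `x` is comparable to `n`. -/
theorem degCount_le {θ : ℝ} (hθ : a + 1 ≤ θ) : ∃ M : ℝ, 0 < M ∧ ∀ (n : ℕ) (x : ℝ), 0 ≤ x →
    degCount ha n x ≤ M * den a n ^ (θ / (a + 1)) * (x + a + θ) ^ (-(1 + θ)) := by
  have hθ0 : 0 < θ := by linarith
  set c : ℝ → ℝ := fun x => (x + a + θ) ^ (-(1 + θ)) with hc
  have hcpos : ∀ x, 0 ≤ x → 0 < c x := fun x hx => Real.rpow_pos_of_pos (by linarith) _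
  set τ := θ / (a + 1) with hτdef
  have hτ : 1 ≤ τ := by rw [hτdef, le_div_iff₀ (by linarith)]; linarith
  -- From `n₁` on, `x + a ≤ den a n` for all `x ≤ n + 1`, so the coefficient of `degCount ha n x` is
  -- nonnegative.
  obtain ⟨n₁, hn₁⟩ := exists_nat_ge (1 / a)
  have hn₁a : 1 ≤ a * n₁ := by rw [div_le_iff₀ ha] at hn₁; linarith
  have hslack : 0 < (1 + a + θ) * c 1 - a * c 0 := by
    have := rpow_neg_sub_one_lt (r := 1 + θ) (z := 1 + a + θ) (by linarith) (by linarith)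
    simp only [hc]
    rw [show 1 + a + θ - (1 + θ) = a by ring, show 1 + a + θ - 1 = 0 + a + θ by ring] at this
    linarith
  have hstep : ∀ x, 1 ≤ x → (x - 1 + a) * c (x - 1) ≤ (x + a + θ) * c x := by
    intro x hx
    have := rpow_neg_sub_one_le (r := 1 + θ) (z := x + a + θ) (by linarith) (by linarith)
    simp only [hc]
    rwa [show x + a + θ - (1 + θ) = x - 1 + a by ring,
      show x + a + θ - 1 = x - 1 + a + θ by ring] at this
  set t₀ := a ^ (τ - 1) with ht₀
  have ht₀pos : 0 < t₀ := Real.rpow_pos_of_pos ha _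
  have hT : ∀ n, t₀ * den a n ≤ den a n ^ τ := by
    intro n
    have hD := den_pos' ha n
    have : den a n ^ τ = den a n ^ (τ - 1) * den a n := by
      rw [← Real.rpow_add_one hD.ne']; ring_nf
    rw [this]
    exact mul_le_mul_of_nonneg_right (Real.rpow_le_rpow ha.le (le_den ha n) (by linarith)) hD.le
  have hc0 := hcpos 0 le_rfl
  have hcn := hcpos n₁ (Nat.cast_nonneg _)
  have haτ : 0 < a ^ τ := Real.rpow_pos_of_pos ha _
  -- The summands absorb, in order, the times up to `n₁`, the source at `x = 0` and the source at `x
  -- = 1`.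
  set M := n₁ / (a ^ τ * c n₁) + 1 / (t₀ * (c 0 * (θ + a))) +
    1 / (t₀ * ((1 + a + θ) * c 1 - a * c 0)) with hM
  have hM1 : n₁ / (a ^ τ * c n₁) ≤ M := by
    have : 0 < 1 / (t₀ * (c 0 * (θ + a))) := by positivity
    have : 0 < 1 / (t₀ * ((1 + a + θ) * c 1 - a * c 0)) := by positivity
    linarith
  have hM2 : 1 / (t₀ * (c 0 * (θ + a))) ≤ M := by
    have : 0 ≤ n₁ / (a ^ τ * c n₁) := by positivity
    have : 0 < 1 / (t₀ * ((1 + a + θ) * c 1 - a * c 0)) := by positivity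
    linarith
  have hM3 : 1 / (t₀ * ((1 + a + θ) * c 1 - a * c 0)) ≤ M := by
    have : 0 ≤ n₁ / (a ^ τ * c n₁) := by positivity
    have : 0 < 1 / (t₀ * (c 0 * (θ + a))) := by positivity
    linarith
  have hMpos : 0 < M := by
    have : 0 < 1 / (t₀ * (c 0 * (θ + a))) := by positivity
    linarith
  refine ⟨M, hMpos, ?_⟩
  have hsmall : ∀ n ≤ n₁, ∀ x, 0 ≤ x → degCount ha n x ≤ M * den a n ^ τ * c x := by
    intro n hn x hx
    have hD := den_pos' ha n
    have hTp : 0 < den a n ^ τ := Real.rpow_pos_of_pos hD _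
    by_cases hxn : (n : ℝ) < x
    · rw [degCount_of_lt ha n hxn]
      have := hcpos x hx
      positivity
    · have hn' : (n : ℝ) ≤ n₁ := by exact_mod_cast hn
      have h1 : c n₁ ≤ c x := by
        apply Real.rpow_le_rpow_of_nonpos (by linarith) (by linarith) (by linarith)
      have h2 : a ^ τ ≤ den a n ^ τ := Real.rpow_le_rpow ha.le (le_den ha n) (by linarith)
      calc degCount ha n x ≤ n := degCount_le_self ha n x
        _ ≤ n₁ := hn'
        _ = n₁ / (a ^ τ * c n₁) * (a ^ τ * c n₁) := by field_simp
        _ ≤ M * (den a n ^ τ * c x) := by gcongr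
        _ = _ := by ring
  intro n
  rcases le_total n n₁ with hn | hn
  · exact hsmall n hn
  induction n, hn using Nat.le_induction with
  | base => exact hsmall n₁ le_rfl
  | succ n hn ih =>
    intro x hx
    have hD := den_pos' ha n
    set D := den a n with hDdef
    have hTp : 0 < D ^ τ := Real.rpow_pos_of_pos hD _
    have hT'p : 0 < den a (n + 1) ^ τ := Real.rpow_pos_of_pos (den_pos' ha _) _
    have hcx := hcpos x hx
    by_cases hxn : ((n + 1 : ℕ) : ℝ) < x
    · rw [degCount_of_lt ha _ hxn]
      positivity
    have hxD : x + a ≤ D := by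
      have h1 : (n₁ : ℝ) ≤ n := by exact_mod_cast hn
      have h2 : a * n₁ ≤ a * n := mul_le_mul_of_nonneg_left h1 ha.le
      push_cast at hxn
      rw [hDdef, den_eq]
      linarith
    have hgrow := den_rpow_succ ha hθ n
    rw [← hτdef, ← hDdef] at hgrow
    rw [degCount_succ]
    have hfac : 0 ≤ 1 - (x + a) / D := by
      rw [sub_nonneg, div_le_one hD]; exact hxD
    have hmain := mul_le_mul_of_nonneg_right (ih x hx) hfac
    have haD : a / D ≤ 1 := by rw [div_le_one hD]; exact le_den ha n
    have haD0 : 0 ≤ a / D := by positivity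
    have hTn := hT n
    suffices h : D * (degCount ha n (x - 1) * ((x - 1 + a) / D) +
        (if x = 0 then 1 - a / D else 0) + (if x = 1 then a / D else 0)) ≤
          M * D ^ τ * (c x * (x + a + θ)) by
      have h3 : D * (M * D ^ τ * c x * (1 - (x + a) / D)) = M * D ^ τ * c x * (D - (x + a)) := by
        field_simp
      have h4 : M * c x * (D ^ τ * (D + θ)) ≤ M * c x * (D * den a (n + 1) ^ τ) := by gcongr
      have h5 := mul_le_mul_of_nonneg_left hmain hD.le
      refine le_of_mul_le_mul_left ?_ hD
      calc _ = D * (degCount ha n x * (1 - (x + a) / D)) +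
            D * (degCount ha n (x - 1) * ((x - 1 + a) / D) +
            (if x = 0 then 1 - a / D else 0) + (if x = 1 then a / D else 0)) := by ring
        _ ≤ M * D ^ τ * c x * (D - (x + a)) + M * D ^ τ * (c x * (x + a + θ)) :=
            add_le_add (h5.trans h3.le) h
        _ = M * c x * (D ^ τ * (D + θ)) := by ring
        _ ≤ M * c x * (D * den a (n + 1) ^ τ) := h4
        _ = _ := by ring
    by_cases hx1 : x < 1
    · rw [degCount_of_neg ha n (by linarith), if_neg hx1.ne]
      by_cases hx0 : x = 0
      · subst hx0
        simp only [if_true, zero_mul, zero_add, add_zero]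
        have h6 : 1 ≤ M * (t₀ * (c 0 * (θ + a))) := by
          rwa [div_le_iff₀ (by positivity)] at hM2
        calc D * (1 - a / D) ≤ D * 1 := by gcongr; linarith
          _ ≤ D * (M * (t₀ * (c 0 * (θ + a)))) := by gcongr
          _ = M * (t₀ * D) * (c 0 * (a + θ)) := by ring
          _ ≤ M * D ^ τ * (c 0 * (a + θ)) := by gcongr
      · simp only [hx0, if_false, zero_mul, add_zero, mul_zero]
        positivity
    · push Not at hx1
      have hx0 : x ≠ 0 := by linarith
      have h7 := mul_le_mul_of_nonneg_right (ih (x - 1) (by linarith))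
        (show 0 ≤ x - 1 + a by linarith)
      have h8 : D * (degCount ha n (x - 1) * ((x - 1 + a) / D)) =
          degCount ha n (x - 1) * (x - 1 + a) := by field_simp
      simp only [hx0, if_false, add_zero]
      rw [mul_add, h8]
      by_cases h1 : x = 1
      · subst h1
        simp only [if_true]
        have h6 : 1 ≤ M * (t₀ * ((1 + a + θ) * c 1 - a * c 0)) := by
          rwa [div_le_iff₀ (by positivity)] at hM3
        have h9 : D * (a / D) ≤ M * D ^ τ * ((1 + a + θ) * c 1 - a * c 0) :=
          calc D * (a / D) ≤ D * 1 := by gcongr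
            _ ≤ D * (M * (t₀ * ((1 + a + θ) * c 1 - a * c 0))) := by gcongr
            _ = M * (t₀ * D) * ((1 + a + θ) * c 1 - a * c 0) := by ring
            _ ≤ _ := by gcongr
        have h10 : c (1 - 1) = c 0 := by norm_num
        have h7' : degCount ha n (1 - 1) * (1 - 1 + a) ≤ M * D ^ τ * c (1 - 1) * (1 - 1 + a) := h7
        rw [h10] at h7'
        calc _ ≤ M * D ^ τ * c 0 * (1 - 1 + a) +
              M * D ^ τ * ((1 + a + θ) * c 1 - a * c 0) := add_le_add h7' h9
          _ = _ := by ring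
      · simp only [h1, if_false, mul_zero, add_zero]
        calc _ ≤ M * D ^ τ * c (x - 1) * (x - 1 + a) := h7
          _ = M * D ^ τ * ((x - 1 + a) * c (x - 1)) := by ring
          _ ≤ M * D ^ τ * ((x + a + θ) * c x) :=
            mul_le_mul_of_nonneg_left (hstep x hx1) (by positivity)
          _ = _ := by ring

/-! ### The stationary profile and its supersolution inequalities -/

/-- The weight of the in-degree in the stationary profile. -/
def tilt (a : ℝ) : ℝ := 4 * (a + 2) ^ 2

/-- The offset of the stationary profile. -/
def offset (a : ℝ) : ℝ := 8 * (a + 9 / 8) * tilt a * (1 / a + 2 * a + 4)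

/-- A supersolution of the stationary equation of the joint distribution of the in-degree and of the
weight of the neighbourhood. -/
def profile (a x y : ℝ) : ℝ :=
  (x + a + 1 / 2) ^ (-(3 / 2) : ℝ) * (y + tilt a * x + offset a) ^ (-(1 + a))

/-- A reversed Bernoulli inequality: raising the linear coefficient from `1 + a` to `a + 9 / 8`
absorbs the quadratic error once `t / m` is small. -/
theorem rpow_sub_le {a : ℝ} (ha : 0 < a) {t m : ℝ} (ht : 0 < t)
    (hm : 8 * (a + 9 / 8) * (1 + a) * t ≤ m) :
    (m - t) ^ (-(1 + a)) ≤ (1 + (a + 9 / 8) * (t / m)) * m ^ (-(1 + a)) := by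
  have hm1 : 8 * (a + 9 / 8) * (1 + a) * t = 9 * t + (17 * a + 8 * a ^ 2) * t := by ring
  have hp : 0 ≤ (17 * a + 8 * a ^ 2) * t := by positivity
  have htm : t < m := by linarith
  have hm0 : 0 < m := by linarith
  set w := t / m with hw
  have hw0 : 0 < w := by positivity
  have hw1 : 8 * (a + 9 / 8) * (1 + a) * w ≤ 1 := by
    rw [hw, mul_div_assoc', div_le_one hm0]; exact hm
  have h := one_add_mul_self_le_rpow_one_add (s := -w) (p := 1 + a) (by nlinarith) (by linarith)
  have e : 1 + -w = (m - t) / m := by rw [hw]; field_simp; ring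
  rw [e, Real.div_rpow (by linarith) hm0.le] at h
  have h1 : 0 < (m - t) ^ (1 + a) := Real.rpow_pos_of_pos (by linarith) _
  have h2 : 0 < m ^ (1 + a) := Real.rpow_pos_of_pos hm0 _
  rw [Real.rpow_neg (by linarith), Real.rpow_neg hm0.le, ← div_eq_mul_inv, inv_eq_one_div,
    div_le_div_iff₀ h1 h2, one_mul]
  rw [le_div_iff₀ h2] at h
  have h3 : 1 ≤ (1 + (a + 9 / 8) * w) * (1 + (1 + a) * -w) := by
    have : (1 + (a + 9 / 8) * w) * (1 + (1 + a) * -w) =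
      1 + w * (1 / 8) * (1 - 8 * (a + 9 / 8) * (1 + a) * w) := by ring
    rw [this]
    have : 0 ≤ w * (1 / 8) * (1 - 8 * (a + 9 / 8) * (1 + a) * w) :=
      mul_nonneg (by positivity) (by linarith)
    linarith
  calc m ^ (1 + a) = 1 * m ^ (1 + a) := by ring
    _ ≤ (1 + (a + 9 / 8) * w) * (1 + (1 + a) * -w) * m ^ (1 + a) := by gcongr
    _ = (1 + (a + 9 / 8) * w) * ((1 + (1 + a) * -w) * m ^ (1 + a)) := by ring
    _ ≤ _ := mul_le_mul_of_nonneg_left h (by positivity)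

theorem one_le_tilt {a : ℝ} (ha : 0 < a) : 1 ≤ tilt a := by unfold tilt; nlinarith

/-- What the offset is for: smallness of `tilt a / m` in `rpow_sub_le`, the drift bound in
`profile_coeff`, the bounded range of `x` in `profile_coeff_of_neg`, and positivity of the base. -/
theorem le_offset {a : ℝ} (ha : 0 < a) :
    8 * (a + 9 / 8) * (1 + a) * tilt a ≤ offset a ∧ tilt a * (a + 1 / 2) + a ≤ offset a ∧
      8 * (a + 9 / 8) * tilt a * (1 / a + a + 3 / 2) ≤ offset a ∧ 1 ≤ offset a := by
  have hB := one_le_tilt ha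
  have hi : 0 < 1 / a := by positivity
  have hr : 1 ≤ 8 * (a + 9 / 8) := by linarith
  have hrB : tilt a ≤ 8 * (a + 9 / 8) * tilt a := le_mul_of_one_le_left (by linarith) hr
  have hpos : 0 < 8 * (a + 9 / 8) * tilt a := by linarith
  unfold offset
  refine ⟨?_, ?_, ?_, ?_⟩
  · nlinarith [mul_pos hpos hi, mul_pos hpos ha]
  · have : a ≤ tilt a * a := le_mul_of_one_le_left ha.le hB
    nlinarith [mul_pos hpos hi, mul_pos hpos ha,
      mul_le_mul_of_nonneg_right hrB (show 0 ≤ 2 * a + 1 / 2 by linarith)]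
  · nlinarith [mul_pos hpos hi, mul_pos hpos ha]
  · nlinarith [mul_pos hpos hi, mul_pos hpos ha]

theorem profile_pos {a : ℝ} (ha : 0 < a) {x y : ℝ} (hx : 0 ≤ x) (hy : 0 ≤ y) :
    0 < profile a x y := by
  have hB := one_le_tilt ha
  have hK := (le_offset ha).2.2.2
  have : 0 ≤ tilt a * x := mul_nonneg (by linarith) hx
  exact mul_pos (Real.rpow_pos_of_pos (by linarith) _) (Real.rpow_pos_of_pos (by linarith) _)

theorem profile_sub_one_left {a : ℝ} (ha : 0 < a) {x y : ℝ} (hx : 1 ≤ x) (hy : 0 ≤ y) :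
    (x - 1 + a) * profile a (x - 1) y ≤ (x + a + 1 / 2) *
      (1 + (a + 9 / 8) * (tilt a / (y + tilt a * x + offset a))) * profile a x y := by
  have hB := one_le_tilt ha
  obtain ⟨hK1, -, -, hK4⟩ := le_offset ha
  have hBx : tilt a * 1 ≤ tilt a * x := mul_le_mul_of_nonneg_left hx (by linarith)
  have h1 := rpow_neg_sub_one_le (r := 3 / 2) (z := x + a + 1 / 2) (by norm_num) (by linarith)
  rw [show x + a + 1 / 2 - 3 / 2 = x - 1 + a by ring,
    show x + a + 1 / 2 - 1 = x - 1 + a + 1 / 2 by ring] at h1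
  have h2 := rpow_sub_le ha (t := tilt a) (m := y + tilt a * x + offset a) (by linarith)
    (by linarith)
  rw [show y + tilt a * x + offset a - tilt a = y + tilt a * (x - 1) + offset a by ring] at h2
  unfold profile
  have h3 : 0 ≤ (y + tilt a * (x - 1) + offset a) ^ (-(1 + a)) :=
    Real.rpow_nonneg (by linarith) _
  have h4 : 0 ≤ (x + a + 1 / 2) * (x + a + 1 / 2) ^ (-(3 / 2) : ℝ) :=
    mul_nonneg (by linarith) (Real.rpow_nonneg (by linarith) _)
  have := mul_le_mul h1 h2 h3 h4
  linarith

theorem profile_sub_one_right {a : ℝ} (ha : 0 < a) {x y : ℝ} (hx : 0 ≤ x) (hy : 0 ≤ y) :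
    profile a x (y - 1) ≤
      (1 + (a + 9 / 8) * (1 / (y + tilt a * x + offset a))) * profile a x y := by
  have hB := one_le_tilt ha
  obtain ⟨hK1, -, -, hK4⟩ := le_offset ha
  have hBx : 0 ≤ tilt a * x := mul_nonneg (by linarith) hx
  have hK1' : 8 * (a + 9 / 8) * (1 + a) * 1 ≤ 8 * (a + 9 / 8) * (1 + a) * tilt a := by gcongr
  have h2 := rpow_sub_le ha (t := 1) (m := y + tilt a * x + offset a) (by linarith)
    (by linarith)
  rw [show y + tilt a * x + offset a - 1 = y - 1 + tilt a * x + offset a by ring] at h2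
  unfold profile
  have := mul_le_mul_of_nonneg_left h2
    (Real.rpow_nonneg (show 0 ≤ x + a + 1 / 2 by linarith) (-(3 / 2) : ℝ))
  linarith

/-- The coefficient inequality behind the supersolution property. -/
theorem profile_coeff {a : ℝ} (ha : 0 < a) {x y γ : ℝ} (hx : 0 ≤ x) (hy : 0 ≤ y) (hγ : γ ≤ 1) :
    (x + a + 1 / 2) * (1 + (a + 9 / 8) * (tilt a / (y + tilt a * x + offset a))) +
      (y - 1 + a * (x + γ)) * (1 + (a + 9 / 8) * (1 / (y + tilt a * x + offset a))) + 1 / 8 ≤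
        a + 1 + (x + a) + (y + a * (x + γ)) := by
  have hB := one_le_tilt ha
  obtain ⟨hK1, hK2, -, hK4⟩ := le_offset ha
  have hBx : 0 ≤ tilt a * x := mul_nonneg (by linarith) hx
  set m := y + tilt a * x + offset a with hm
  have hm0 : 0 < m := by linarith
  have hB0 : 0 < tilt a := by linarith
  -- The drift of `y` contains `a * x`, which `y` does not control. Including `tilt a * x` in `m`
  -- bounds the total drift of `m` by nearly `m`.
  have h1 : tilt a * (x + a + 1 / 2) + (y - 1 + a * (x + γ)) ≤ m * (1 + a / tilt a) := by
    have e : m * (1 + a / tilt a) = m + a * x + a / tilt a * (y + offset a) := by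
      rw [hm]; field_simp; ring
    have : 0 ≤ a / tilt a * (y + offset a) := mul_nonneg (by positivity) (by linarith)
    have : a * γ ≤ a * 1 := mul_le_mul_of_nonneg_left hγ ha.le
    nlinarith
  -- The tilt is large enough for an excess of `1 / 4` here. The budget is then exact: `1 / 2 - 1 +
  -- (a + 11 / 8) + 1 / 8 = a + 1`, the increment of `den`.
  have h2 : (a + 9 / 8) * (1 + a / tilt a) ≤ a + 11 / 8 := by
    have : (a + 9 / 8) * (a / tilt a) ≤ 1 / 4 := by
      rw [mul_div_assoc', div_le_iff₀ hB0]; unfold tilt; nlinarith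
    linarith
  have h3 : (a + 9 / 8) * ((tilt a * (x + a + 1 / 2) + (y - 1 + a * (x + γ))) / m) ≤
      a + 11 / 8 := by
    refine le_trans (mul_le_mul_of_nonneg_left ?_ (by linarith)) h2
    rw [div_le_iff₀ hm0]; linarith
  have e : (x + a + 1 / 2) * (1 + (a + 9 / 8) * (tilt a / m)) +
      (y - 1 + a * (x + γ)) * (1 + (a + 9 / 8) * (1 / m)) = (x + a + 1 / 2) +
      (y - 1 + a * (x + γ)) +
      (a + 9 / 8) * ((tilt a * (x + a + 1 / 2) + (y - 1 + a * (x + γ))) / m) := by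
    field_simp; ring
  rw [e]
  linarith

/-- A negative rate of inflow from `y - 1` can be dropped. It forces `x ≤ 1 / a + 1`, so the offset
makes the tilt correction at most `1 / 8`. -/
theorem profile_coeff_of_neg {a : ℝ} (ha : 0 < a) {x y γ : ℝ} (hx : 0 ≤ x) (hy : 0 ≤ y)
    (hγ : -1 ≤ γ) (hxγ : 0 ≤ x + γ) (h : y - 1 + a * (x + γ) < 0) :
    (x + a + 1 / 2) * (1 + (a + 9 / 8) * (tilt a / (y + tilt a * x + offset a))) + 1 / 8 ≤
        a + 1 + (x + a) + (y + a * (x + γ)) := by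
  have hB := one_le_tilt ha
  obtain ⟨hK1, hK2, hK3, hK4⟩ := le_offset ha
  have hBx : 0 ≤ tilt a * x := mul_nonneg (by linarith) hx
  have hx2 : x ≤ 1 / a + 1 := by
    have : x + γ ≤ 1 / a := by rw [le_div_iff₀ ha]; linarith
    linarith
  have h4 : 0 ≤ a * (x + γ) := mul_nonneg ha.le hxγ
  have h5 : (x + a + 1 / 2) * ((a + 9 / 8) * (tilt a / (y + tilt a * x + offset a))) ≤ 1 / 8 := by
    rw [mul_div_assoc', mul_div_assoc', div_le_iff₀ (by linarith)]
    have : (x + a + 1 / 2) * ((a + 9 / 8) * tilt a) ≤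
        (1 / a + a + 3 / 2) * ((a + 9 / 8) * tilt a) :=
      mul_le_mul_of_nonneg_right (by linarith) (by positivity)
    linarith
  linarith

theorem shift_le (l : Bool) : shift l ≤ 1 := by cases l <;> norm_num [shift]

theorem le_shift (l : Bool) : -1 ≤ shift l := by cases l <;> norm_num [shift]

theorem rpow_neg_le_mul {u v r c : ℝ} (hu : 0 < u) (hv : 0 < v) (hc : 0 < c) (hr : 0 ≤ r)
    (h : u ≤ c * v) : v ^ (-r) ≤ c ^ r * u ^ (-r) := by
  have h1 : (c * v) ^ (-r) ≤ u ^ (-r) := Real.rpow_le_rpow_of_nonpos hu h (by linarith)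
  rw [Real.mul_rpow hc.le hv.le] at h1
  have h2 : c ^ r * c ^ (-r) = 1 := by rw [← Real.rpow_add hc]; simp
  calc v ^ (-r) = c ^ r * (c ^ (-r) * v ^ (-r)) := by rw [← mul_assoc, h2, one_mul]
    _ ≤ _ := by gcongr

/-- With `θ = a + 1`, the degree count times the attachment probability loses its factor `den` and
one power of `y`, leaving `y ^ (-(1 + a))`. -/
theorem source_le_profile : ∃ M : ℝ, 0 < M ∧ ∀ (l : Bool) (n : ℕ) (x y : ℝ), 0 ≤ x → 0 ≤ y →
    (if l = false ∧ x = 0 then degCount ha n (y - 1) * ((y - 1 + a) / den a n) else 0) +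
      (if l = true ∧ x = 1 ∧ y = 0 then a / den a n else 0) ≤ M * profile a x y := by
  obtain ⟨M₁, hM₁, hdeg⟩ := degCount_le ha (le_refl (a + 1))
  have hB := one_le_tilt ha
  have hK := (le_offset ha).2.2.2
  set κ := offset a / (2 * a) + 1 with hκ
  have hκ0 : 0 < κ := by have : 0 < offset a / (2 * a) := by positivity
                         linarith
  have hp0 : 0 < (a + 1 / 2) ^ (-(3 / 2) : ℝ) := Real.rpow_pos_of_pos (by linarith) _
  set M₂ := M₁ * κ ^ (1 + a) / (a + 1 / 2) ^ (-(3 / 2) : ℝ) with hM₂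
  have hκp : 0 < κ ^ (1 + a) := Real.rpow_pos_of_pos hκ0 _
  have hM₂0 : 0 < M₂ := by positivity
  have hprof := profile_pos ha zero_le_one (le_refl 0)
  refine ⟨M₂ + 1 / profile a 1 0, by positivity, ?_⟩
  intro l n x y hx hy
  have hD := den_pos' ha n
  have hxy := profile_pos ha hx hy
  rw [add_mul]
  refine add_le_add ?_ ?_
  · split_ifs with h
    · obtain ⟨rfl, rfl⟩ := h
      by_cases hy1 : y < 1
      · rw [degCount_of_neg ha n (by linarith), zero_mul]
        positivity
      · push Not at hy1
        have h1 := hdeg n (y - 1) (by linarith)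
        rw [div_self (by linarith), Real.rpow_one,
          show y - 1 + a + (a + 1) = y + 2 * a by ring] at h1
        have hy2 : 0 < y + 2 * a := by linarith
        have h2 : y + offset a ≤ κ * (y + 2 * a) := by
          have : κ * (y + 2 * a) = y + offset a + 2 * a + offset a / (2 * a) * y := by
            rw [hκ]; field_simp; ring
          have : 0 ≤ offset a / (2 * a) * y := by positivity
          linarith
        have h3 := rpow_neg_le_mul (r := 1 + a) (by linarith) hy2 hκ0 (by linarith) h2
        have h4 : (y + 2 * a) ^ (-(1 + (a + 1))) * (y + 2 * a) = (y + 2 * a) ^ (-(1 + a)) := by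
          rw [← Real.rpow_add_one hy2.ne']; ring_nf
        calc degCount ha n (y - 1) * ((y - 1 + a) / den a n)
            ≤ M₁ * den a n * (y + 2 * a) ^ (-(1 + (a + 1))) * ((y + 2 * a) / den a n) := by
              apply mul_le_mul h1 _ (div_nonneg (by linarith) hD.le) (by positivity)
              gcongr <;> linarith
          _ = M₁ * ((y + 2 * a) ^ (-(1 + (a + 1))) * (y + 2 * a)) := by field_simp
          _ = M₁ * (y + 2 * a) ^ (-(1 + a)) := by rw [h4]
          _ ≤ M₁ * (κ ^ (1 + a) * (y + offset a) ^ (-(1 + a))) := by gcongr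
          _ = M₂ * profile a 0 y := by
              rw [hM₂, profile]
              simp only [mul_zero, add_zero, zero_add]
              field_simp
    · positivity
  · split_ifs with h
    · obtain ⟨-, rfl, rfl⟩ := h
      rw [div_mul_cancel₀ _ hprof.ne', div_le_one hD]
      exact le_den ha n
    · positivity

/-- Where the staying coefficient is negative, `x + y ≤ n + 1` forces `x ≥ n - 1 - 1 / a`. With `D =
den a (n + 1)`, the chosen `θ` makes the degree bound of order `D ^ (-(a + 2))`, below the required
`D ^ (-(a + 3 / 2))`. -/
theorem degCount_le_profile : ∃ M : ℝ, 0 < M ∧ ∀ (l : Bool) (n : ℕ) (x y : ℝ), 0 ≤ x → 0 ≤ y →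
    x + y ≤ n + 1 → den a n < (x + a) + (y + a * (x + shift l)) →
      degCount ha (n + 1) x ≤ M * den a (n + 1) * profile a x y := by
  set θ := (a + 1) ^ 2 / a with hθ
  have hθ1 : a + 1 ≤ θ := by
    rw [hθ, le_div_iff₀ ha]; nlinarith
  have hτ : θ / (a + 1) = (a + 1) / a := by rw [hθ]; field_simp
  obtain ⟨M₁, hM₁, hdeg⟩ := degCount_le ha hθ1
  have hB := one_le_tilt ha
  have hK := (le_offset ha).2.2.2
  set κ := (a + 1) * (4 + 1 / a) with hκ
  have hκ0 : 0 < κ := by positivity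
  set μ := 2 + tilt a + offset a with hμ
  have hμ0 : 0 < μ := by linarith
  set M₂ := M₁ * κ ^ (1 + θ) / (μ ^ (-(3 / 2) : ℝ) * μ ^ (-(1 + a))) with hM₂
  have hκp : 0 < κ ^ (1 + θ) := Real.rpow_pos_of_pos hκ0 _
  have hμ1 : 0 < μ ^ (-(3 / 2) : ℝ) := Real.rpow_pos_of_pos hμ0 _
  have hμ2 : 0 < μ ^ (-(1 + a)) := Real.rpow_pos_of_pos hμ0 _
  refine ⟨M₂, by positivity, ?_⟩
  intro l n x y hx hy hxy hr
  have hD := den_pos' ha (n + 1)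
  set D := den a (n + 1) with hDdef
  have hDeq : D = (a + 1) * (n + 1) + a := by rw [hDdef, den_eq]; push_cast; ring
  have hn0 : (0 : ℝ) ≤ n := Nat.cast_nonneg n
  have hDn : (n : ℝ) + 1 + a ≤ D := by
    rw [hDeq]; nlinarith [mul_nonneg ha.le hn0]
  have hxn : (n : ℝ) ≤ x + 1 + 1 / a := by
    rw [den_eq] at hr
    have h1 : a * shift l ≤ a * 1 := mul_le_mul_of_nonneg_left (shift_le l) ha.le
    have h2 : a * n ≤ a * (x + 1 + 1 / a) := by
      have : a * (x + 1 + 1 / a) = a * x + a + 1 := by field_simp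
      nlinarith
    exact le_of_mul_le_mul_left h2 ha
  have hDx : D ≤ κ * (x + a + θ) := by
    have h1 : 0 < 1 / a := by positivity
    have h2 : (n : ℝ) + 2 ≤ (4 + 1 / a) * (x + a + θ) := by
      have : 1 ≤ x + a + θ := by linarith
      have h4 : 1 / a * 1 ≤ 1 / a * (x + a + θ) := mul_le_mul_of_nonneg_left this h1.le
      linarith
    have h3 := mul_le_mul_of_nonneg_left h2 (show 0 ≤ a + 1 by linarith)
    rw [hDeq, hκ]
    linarith
  have h1 := hdeg (n + 1) x hx
  rw [hτ] at h1
  have h2 := rpow_neg_le_mul (r := 1 + θ) hD (by linarith) hκ0 (by linarith) hDx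
  have h3 : μ ^ (-(3 / 2) : ℝ) * D ^ (-(3 / 2) : ℝ) ≤ (x + a + 1 / 2) ^ (-(3 / 2) : ℝ) := by
    rw [← Real.mul_rpow hμ0.le hD.le]
    refine Real.rpow_le_rpow_of_nonpos (by linarith) ?_ (by norm_num)
    have : 2 * D ≤ μ * D := mul_le_mul_of_nonneg_right (by linarith) hD.le
    linarith
  have h4 : μ ^ (-(1 + a)) * D ^ (-(1 + a)) ≤ (y + tilt a * x + offset a) ^ (-(1 + a)) := by
    rw [← Real.mul_rpow hμ0.le hD.le]
    have h5 : 0 ≤ tilt a * x := mul_nonneg (by linarith) hx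
    refine Real.rpow_le_rpow_of_nonpos (by linarith) ?_ (by linarith)
    have h6 : tilt a * x ≤ tilt a * D := mul_le_mul_of_nonneg_left (by linarith) (by linarith)
    have h7 : offset a * 1 ≤ offset a * D := mul_le_mul_of_nonneg_left (by linarith) (by linarith)
    rw [hμ]
    linarith
  have h5 : D ^ ((a + 1) / a) * D ^ (-(1 + θ)) ≤
      D * (D ^ (-(3 / 2) : ℝ) * D ^ (-(1 + a))) := by
    have e : D * (D ^ (-(3 / 2) : ℝ) * D ^ (-(1 + a))) = D ^ (1 + (-(3 / 2) + -(1 + a))) := by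
      rw [Real.rpow_add hD, Real.rpow_add hD, Real.rpow_one]
    rw [← Real.rpow_add hD, e]
    refine Real.rpow_le_rpow_of_exponent_le (by linarith) ?_
    have : (a + 1) / a - θ = -(a + 1) := by rw [hθ]; field_simp; ring
    linarith
  calc degCount ha (n + 1) x ≤ M₁ * D ^ ((a + 1) / a) * (x + a + θ) ^ (-(1 + θ)) := h1
    _ ≤ M₁ * D ^ ((a + 1) / a) * (κ ^ (1 + θ) * D ^ (-(1 + θ))) := by gcongr
    _ = M₁ * κ ^ (1 + θ) * (D ^ ((a + 1) / a) * D ^ (-(1 + θ))) := by ring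
    _ ≤ M₁ * κ ^ (1 + θ) * (D * (D ^ (-(3 / 2) : ℝ) * D ^ (-(1 + a)))) := by gcongr
    _ = M₂ * D * ((μ ^ (-(3 / 2) : ℝ) * D ^ (-(3 / 2) : ℝ)) *
          (μ ^ (-(1 + a)) * D ^ (-(1 + a)))) := by
        rw [hM₂]; field_simp
    _ ≤ M₂ * D * profile a x y := by
        unfold profile
        gcongr

/-! ### Upper bounds for the joint counts and for the expectation -/

theorem classCount_le : ∃ M : ℝ, 0 < M ∧ ∀ (n : ℕ) (l : Bool) (x y : ℝ), 0 ≤ x → 0 ≤ y →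
    classCount ha l n x y ≤ M * den a n * profile a x y := by
  obtain ⟨M₁, hM₁, hsource⟩ := source_le_profile ha
  obtain ⟨M₂, hM₂, hexc⟩ := degCount_le_profile ha
  -- The source may use the `1 / 8` reserved in the coefficient inequalities, hence `8 * M₁`; `M₂`
  -- serves the region of negative staying coefficient.
  set M := 8 * M₁ + M₂ with hM
  have hM0 : 0 < M := by positivity
  refine ⟨M, hM0, ?_⟩
  intro n
  induction n with
  | zero =>
    intro l x y hx hy
    rw [classCount_zero]
    have := profile_pos ha hx hy
    have := den_pos' ha 0
    positivity
  | succ n ih =>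
    intro l x y hx hy
    have hp := profile_pos ha hx hy
    have hD' := den_pos' ha (n + 1)
    have hD := den_pos' ha n
    by_cases hxy : ((n + 1 : ℕ) : ℝ) < x + y
    · rw [classCount_of_lt ha l _ hxy]; positivity
    by_cases hl : x + shift l < 0
    · rw [classCount_of_shift ha l _ hl]; positivity
    push_cast at hxy
    push Not at hxy hl
    by_cases hr : den a n < (x + a) + (y + a * (x + shift l))
    · calc classCount ha l (n + 1) x y ≤ degCount ha (n + 1) x := classCount_le_degCount ha l _ x y
        _ ≤ M₂ * den a (n + 1) * profile a x y := hexc l n x y hx hy hxy hr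
        _ ≤ _ := by gcongr; linarith
    push Not at hr
    set D := den a n with hDdef
    set c := profile a x y with hc
    have hs := hsource l n x y hx hy
    rw [classCount_succ, add_assoc, ← hDdef]
    rw [← hDdef, ← hc] at hs
    have hfac : 0 ≤ 1 - (x + a) / D - (y + a * (x + shift l)) / D := by
      rw [sub_sub, ← add_div, sub_nonneg, div_le_one hD]; exact hr
    have h1 := mul_le_mul_of_nonneg_right (ih l x y hx hy) hfac
    have e1 : M * D * c * (1 - (x + a) / D - (y + a * (x + shift l)) / D) =
        M * c * (D - (x + a) - (y + a * (x + shift l))) := by field_simp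
    rw [← hc, e1] at h1
    set w := 1 + (a + 9 / 8) * (tilt a / (y + tilt a * x + offset a)) with hw
    have hB := one_le_tilt ha
    have hK := (le_offset ha).2.2.2
    have hBx : 0 ≤ tilt a * x := mul_nonneg (by linarith) hx
    have hw0 : 0 ≤ w := by
      have : 0 ≤ tilt a / (y + tilt a * x + offset a) := div_nonneg (by linarith) (by linarith)
      positivity
    have h2 : classCount ha l n (x - 1) y * ((x - 1 + a) / D) ≤
        M * c * ((x + a + 1 / 2) * w) := by
      by_cases hx1 : x < 1
      · rw [classCount_of_neg_left ha l n (by linarith), zero_mul]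
        positivity
      · push Not at hx1
        have h3 := profile_sub_one_left ha hx1 hy
        calc _ ≤ M * D * profile a (x - 1) y * ((x - 1 + a) / D) :=
              mul_le_mul_of_nonneg_right (ih l (x - 1) y (by linarith) hy)
                (div_nonneg (by linarith) hD.le)
          _ = M * ((x - 1 + a) * profile a (x - 1) y) := by field_simp
          _ ≤ M * ((x + a + 1 / 2) * w * c) := mul_le_mul_of_nonneg_left h3 hM0.le
          _ = _ := by ring
    have h4 : M₁ * c ≤ M * c * (1 / 8) := by
      have : M₁ * c ≤ (M / 8) * c := mul_le_mul_of_nonneg_right (by linarith) hp.le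
      linarith
    rw [hDdef, den_succ, ← hDdef]
    have hMc : 0 ≤ M * c := by positivity
    by_cases hneg : y - 1 + a * (x + shift l) < 0
    · have h5 : classCount ha l n x (y - 1) * ((y - 1 + a * (x + shift l)) / D) ≤ 0 :=
        mul_nonpos_of_nonneg_of_nonpos (classCount_nonneg ha _ _ _ _)
          (div_nonpos_of_nonpos_of_nonneg hneg.le hD.le)
      have h6 := mul_le_mul_of_nonneg_left
        (profile_coeff_of_neg ha hx hy (le_shift l) hl hneg) hMc
      rw [← hw] at h6
      linarith
    · push Not at hneg
      set w' := 1 + (a + 9 / 8) * (1 / (y + tilt a * x + offset a)) with hw'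
      have hw'0 : 0 ≤ w' := by
        have : 0 ≤ 1 / (y + tilt a * x + offset a) := div_nonneg (by linarith) (by linarith)
        positivity
      have h5 : classCount ha l n x (y - 1) * ((y - 1 + a * (x + shift l)) / D) ≤
          M * c * ((y - 1 + a * (x + shift l)) * w') := by
        by_cases hy1 : y < 1
        · rw [classCount_of_neg_right ha l n _ (by linarith), zero_mul]
          positivity
        · push Not at hy1
          have h3 := profile_sub_one_right ha hx hy
          calc _ ≤ M * D * profile a x (y - 1) * ((y - 1 + a * (x + shift l)) / D) :=
                mul_le_mul_of_nonneg_right (ih l x (y - 1) hx (by linarith))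
                  (div_nonneg hneg hD.le)
            _ = M * (y - 1 + a * (x + shift l)) * profile a x (y - 1) := by field_simp
            _ ≤ M * (y - 1 + a * (x + shift l)) * (w' * c) :=
                mul_le_mul_of_nonneg_left h3 (by positivity)
            _ = _ := by ring
      have h6 := mul_le_mul_of_nonneg_left (profile_coeff ha hx hy (shift_le l)) hMc
      rw [← hw, ← hw'] at h6
      linarith

theorem expectedX_le_const : ∃ M : ℝ, 0 < M ∧ ∀ n k : ℕ, 1 ≤ n → 1 ≤ k →
    expectedX ha n k ≤ M * ((n : ℝ) / (k : ℝ) ^ (1 + a)) := by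
  obtain ⟨M, hM, hle⟩ := classCount_le ha
  have hB := one_le_tilt ha
  have hK := (le_offset ha).2.2.2
  have hsum : Summable fun i : ℕ => ((i : ℝ) + a + 1 / 2) ^ (-(3 / 2) : ℝ) := by
    rw [← summable_nat_add_iff 1]
    refine Summable.of_nonneg_of_le (fun i => Real.rpow_nonneg (by positivity) _) (fun i => ?_)
      ((summable_nat_add_iff 1).2 (Real.summable_nat_rpow.2 (show (-(3 / 2) : ℝ) < -1 by norm_num)))
    refine Real.rpow_le_rpow_of_nonpos (by positivity) (by linarith) (by norm_num)
  set S := ∑' i : ℕ, ((i : ℝ) + a + 1 / 2) ^ (-(3 / 2) : ℝ) with hS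
  have hS0 : 0 ≤ S := tsum_nonneg fun i => Real.rpow_nonneg (by positivity) _
  -- The 4 counts two values of `l` and two weights `k`, `k + 1`; `2 * a + 1` compares `den a n`
  -- with `n`.
  refine ⟨4 * M * (2 * a + 1) * (S + 1), by positivity, ?_⟩
  intro n k hn hk
  have hk0 : (0 : ℝ) < k := by exact_mod_cast hk
  have hn1 : (1 : ℝ) ≤ n := by exact_mod_cast hn
  have hD := den_pos' ha n
  have hDn : den a n ≤ (2 * a + 1) * n := by rw [den_eq]; nlinarith
  have hprof : ∀ (i : ℕ) (y : ℝ), (k : ℝ) ≤ y →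
      profile a i y ≤ ((i : ℝ) + a + 1 / 2) ^ (-(3 / 2) : ℝ) * (k : ℝ) ^ (-(1 + a)) := by
    intro i y hy
    unfold profile
    refine mul_le_mul_of_nonneg_left ?_ (Real.rpow_nonneg (by positivity) _)
    have : 0 ≤ tilt a * i := mul_nonneg (by linarith) (Nat.cast_nonneg i)
    exact Real.rpow_le_rpow_of_nonpos hk0 (by linarith) (by linarith)
  have hkp : 0 ≤ (k : ℝ) ^ (-(1 + a)) := Real.rpow_nonneg hk0.le _
  have hterm : ∀ (l : Bool) (i : ℕ), classCount ha l n i k + classCount ha l n i (k + 1) ≤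
      2 * M * den a n * (k : ℝ) ^ (-(1 + a)) * ((i : ℝ) + a + 1 / 2) ^ (-(3 / 2) : ℝ) := by
    intro l i
    have h1 := (hle n l i k (Nat.cast_nonneg i) hk0.le).trans
      (mul_le_mul_of_nonneg_left (hprof i k le_rfl) (by positivity))
    have h2 := (hle n l i (k + 1) (Nat.cast_nonneg i) (by linarith)).trans
      (mul_le_mul_of_nonneg_left (hprof i (k + 1) (by linarith)) (by positivity))
    linarith
  have hfin : ∑ i ∈ Finset.range (n + 1), ((i : ℝ) + a + 1 / 2) ^ (-(3 / 2) : ℝ) ≤ S :=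
    hsum.sum_le_tsum _ fun i _ => Real.rpow_nonneg (by positivity) _
  calc expectedX ha n k ≤ _ := expectedX_le ha n k
    _ ≤ ∑ l : Bool, ∑ i ∈ Finset.range (n + 1),
        2 * M * den a n * (k : ℝ) ^ (-(1 + a)) * ((i : ℝ) + a + 1 / 2) ^ (-(3 / 2) : ℝ) :=
      Finset.sum_le_sum fun l _ => Finset.sum_le_sum fun i _ => hterm l i
    _ = 4 * M * den a n * (k : ℝ) ^ (-(1 + a)) *
        ∑ i ∈ Finset.range (n + 1), ((i : ℝ) + a + 1 / 2) ^ (-(3 / 2) : ℝ) := by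
      rw [← Finset.mul_sum]; simp; ring
    _ ≤ 4 * M * ((2 * a + 1) * n) * (k : ℝ) ^ (-(1 + a)) * (S + 1) := by
      gcongr; linarith
    _ = _ := by rw [Real.rpow_neg hk0.le]; ring

/-! ### The cutoff and the lower bounds -/

/-- The growing cutoff below which the lower bounds are nontrivial. -/
def cutoff (a ρ : ℝ) (n : ℕ) : ℝ := ρ * (den a n + a) ^ (1 / (1 + a))

include ha in
theorem cutoff_pos {ρ : ℝ} (hρ : 0 < ρ) (n : ℕ) : 0 < cutoff a ρ n :=
  mul_pos hρ (Real.rpow_pos_of_pos (by linarith [den_pos' ha n]) _)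

-- Bernoulli's inequality for the concave power `1 / (1 + a)`: the relative growth per step is at
-- most `1 / (den a n + a)`, matching the growth rate of a degree.
include ha in
theorem cutoff_succ_le {ρ : ℝ} (hρ : 0 < ρ) (n : ℕ) :
    (den a n + a) * cutoff a ρ (n + 1) ≤ (den a n + a + 1) * cutoff a ρ n := by
  set E := den a n + a with hE
  have hE0 : 0 < E := by linarith [den_pos' ha n]
  have h := rpow_one_add_le_one_add_mul_self (s := (a + 1) / E) (p := 1 / (1 + a))
    (by have : 0 ≤ (a + 1) / E := by positivity
        linarith) (by positivity) (by rw [div_le_one (by linarith)]; linarith)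
  have e1 : 1 / (1 + a) * ((a + 1) / E) = 1 / E := by rw [add_comm 1 a]; field_simp
  have e2 : 1 + (a + 1) / E = (den a (n + 1) + a) / E := by
    rw [den_succ, show den a n + a + 1 + a = E + (a + 1) by rw [hE]; ring]; field_simp
  have hE' : 0 < den a (n + 1) + a := by linarith [den_pos' ha (n + 1)]
  rw [e1, e2, Real.div_rpow hE'.le hE0.le, div_le_iff₀ (Real.rpow_pos_of_pos hE0 _)] at h
  have h2 : cutoff a ρ (n + 1) ≤ (1 + 1 / E) * cutoff a ρ n := by
    have := mul_le_mul_of_nonneg_left h hρ.le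
    unfold cutoff
    rw [← hE]
    linarith
  have := mul_le_mul_of_nonneg_left h2 hE0.le
  have e : E * ((1 + 1 / E) * cutoff a ρ n) = (E + 1) * cutoff a ρ n := by field_simp
  linarith

include ha in
/-- The cutoff grows slowly enough. -/
theorem den_mul_sub_le {ρ : ℝ} (hρ : 0 < ρ) (n : ℕ) :
    den a (n + 1) * (1 / cutoff a ρ n - 1 / cutoff a ρ (n + 1)) ≤ 1 / cutoff a ρ n := by
  have hR := cutoff_pos ha hρ n
  have hR' := cutoff_pos ha hρ (n + 1)
  have h3 := cutoff_succ_le ha hρ n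
  set E := den a n + a with hE
  have hd : den a (n + 1) = E + 1 := by rw [den_succ, hE]
  have e3 : den a (n + 1) * (1 / cutoff a ρ n - 1 / cutoff a ρ (n + 1)) =
      1 / cutoff a ρ n + (E * cutoff a ρ (n + 1) - (E + 1) * cutoff a ρ n) /
        (cutoff a ρ n * cutoff a ρ (n + 1)) := by
    rw [hd]; field_simp; ring
  rw [e3]
  have : (E * cutoff a ρ (n + 1) - (E + 1) * cutoff a ρ n) /
        (cutoff a ρ n * cutoff a ρ (n + 1)) ≤ 0 :=
    div_nonpos_of_nonpos_of_nonneg (by linarith) (by positivity)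
  linarith

include ha in
theorem eventually_cutoff_le {ρ : ℝ} (hρ : 0 < ρ) :
    ∃ n₀ : ℕ, 1 ≤ n₀ ∧ 1 ≤ a * n₀ ∧ ∀ n ≥ n₀, cutoff a ρ n + 2 ≤ n := by
  have hneg : 0 < a / (1 + a) := by positivity
  -- This constant makes the cutoff at most `n / 4 + 1`, which suffices for `n ≥ 4`.
  have h1 := (tendsto_rpow_neg_atTop hneg).eventually_le_const
    (show 0 < 1 / (4 * (a + 1) * ρ) by positivity)
  obtain ⟨E₀, hE₀⟩ := Filter.eventually_atTop.1 h1
  obtain ⟨n₁, hn₁⟩ := exists_nat_ge E₀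
  obtain ⟨n₂, hn₂⟩ := exists_nat_ge (1 / a)
  refine ⟨n₁ + n₂ + 4, by omega, ?_, ?_⟩
  · rw [div_le_iff₀ ha] at hn₂
    push_cast
    have : 0 ≤ a * n₁ := by positivity
    linarith
  · intro n hn
    have hn' : (n₁ : ℝ) + n₂ + 4 ≤ n := by exact_mod_cast hn
    have hn0 : (0 : ℝ) ≤ n₂ := Nat.cast_nonneg _
    have hn1 : (0 : ℝ) ≤ n₁ := Nat.cast_nonneg _
    have hE : den a n + a = (a + 1) * n + 2 * a := by rw [den_eq]; ring
    have hE0 : 0 < den a n + a := by linarith [den_pos' ha n]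
    have han : 0 ≤ a * n := by positivity
    have h2 := hE₀ (den a n + a) (by linarith)
    have h3 : (den a n + a) ^ (1 / (1 + a)) =
        (den a n + a) ^ (-(a / (1 + a))) * (den a n + a) := by
      rw [← Real.rpow_add_one hE0.ne']
      congr 1
      field_simp
      ring
    have h4 : cutoff a ρ n ≤ ρ * (1 / (4 * (a + 1) * ρ) * (den a n + a)) := by
      unfold cutoff
      rw [h3]
      gcongr
    have h5 : ρ * (1 / (4 * (a + 1) * ρ) * (den a n + a)) = n / 4 + a / (2 * (a + 1)) := by
      rw [hE]; field_simp; ring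
    have h6 : a / (2 * (a + 1)) ≤ 1 := by rw [div_le_one (by positivity)]; linarith
    linarith

-- The cutoff grows by at most one per step, so the predecessor of a value below the new cutoff lies
-- below the old one.
include ha in
theorem le_cutoff_of_succ {ρ : ℝ} (hρ : 0 < ρ) {n : ℕ} (hn : cutoff a ρ n + 2 ≤ n) {x : ℝ}
    (hx : x + 1 ≤ cutoff a ρ (n + 1)) : x ≤ cutoff a ρ n := by
  have h := cutoff_succ_le ha hρ n
  have hE : 0 < den a n + a := by linarith [den_pos' ha n]
  have h1 : cutoff a ρ n ≤ den a n + a := by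
    rw [den_eq]
    have := mul_nonneg ha.le (Nat.cast_nonneg (α := ℝ) n)
    linarith
  have h2 : (den a n + a) * cutoff a ρ (n + 1) ≤ (den a n + a) * (cutoff a ρ n + 1) := by
    linarith
  linarith [le_of_mul_le_mul_left h2 hE]

/-- Bernoulli's inequality for `(1 + 1 / z) ^ r`. With `z = i + a` and `r = 2 + a` it makes `(i + a)
^ (-(2 + a))` a subsolution. -/
theorem le_succ_rpow {r z : ℝ} (hr : 1 ≤ r) (hz : 0 < z) :
    (z + r) * (z + 1) ^ (-r) ≤ z * z ^ (-r) := by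
  have h := one_add_mul_self_le_rpow_one_add (s := 1 / z) (p := r)
    (by have : 0 < 1 / z := by positivity
        linarith) hr
  have e : 1 + 1 / z = (z + 1) / z := by field_simp
  rw [e, Real.div_rpow (by linarith) hz.le] at h
  have h1 : 0 < (z + 1) ^ r := Real.rpow_pos_of_pos (by linarith) _
  have h2 : 0 < z ^ r := Real.rpow_pos_of_pos hz _
  rw [Real.rpow_neg (by linarith), Real.rpow_neg hz.le, ← div_eq_mul_inv, ← div_eq_mul_inv,
    div_le_div_iff₀ h1 h2]
  have h3 : 1 + r * (1 / z) = (z + r) / z := by field_simp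
  rw [h3, div_le_div_iff₀ hz h2] at h
  linarith

theorem add_le_den {n : ℕ} (hn : 1 ≤ a * n) {x : ℝ} (hx : x ≤ n + 1) : x + a ≤ den a n := by
  rw [den_eq]; linarith

include ha in
theorem div_den_lt_one {n : ℕ} (hn : 1 ≤ n) : a / den a n < 1 := by
  rw [div_lt_one (den_pos' ha n), den_eq]
  have : (1 : ℝ) ≤ n := by exact_mod_cast hn
  nlinarith

/-- The first vertex always carries a loop, so the second is the earliest without one; it may then
receive every later edge. -/
theorem properCount_pos (n : ℕ) (i : ℕ) (h : i + 2 ≤ n) : 0 < properCount ha n i := by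
  induction n generalizing i with
  | zero => omega
  | succ n ih =>
    have hD := den_pos' ha n
    have hn : 1 ≤ n := by omega
    rw [properCount_succ]
    have hi : (i : ℝ) ≤ n := by exact_mod_cast (show i ≤ n by omega)
    have h1 : 0 ≤ properCount ha n i * (1 - (i + a) / den a n) := by
      refine mul_nonneg (properCount_nonneg ha _ _) ?_
      rw [sub_nonneg, div_le_one hD, den_eq]
      have := mul_nonneg ha.le (Nat.cast_nonneg (α := ℝ) n)
      linarith
    have hlt := div_den_lt_one ha hn
    rcases i with _ | i
    · simp only [Nat.cast_zero] at h1 ⊢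
      rw [properCount_of_neg ha n (x := 0 - 1) (by norm_num)]
      simp only [zero_mul, add_zero, if_true]
      linarith
    · have h2 := ih i (by omega)
      have e : ((i + 1 : ℕ) : ℝ) - 1 = i := by push_cast; ring
      have h3 : ((i + 1 : ℕ) : ℝ) ≠ 0 := by positivity
      rw [e, if_neg h3]
      have : 0 < properCount ha n i * ((i + a) / den a n) := by positivity
      linarith

theorem leafCount_pos (n : ℕ) (i : ℕ) (hn : 1 ≤ a * n) (h : i + 2 ≤ n) :
    0 < leafCount ha (n + 1) (i + 1) := by
  have hD := den_pos' ha n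
  rw [leafCount_succ, show (i : ℝ) + 1 - 1 = i by ring]
  have hi : (i : ℝ) + 2 ≤ n := by exact_mod_cast h
  have h1 : 0 ≤ leafCount ha n (i + 1) * (1 - ((i : ℝ) + 1 + 2 * a) / den a n) := by
    refine mul_nonneg (leafCount_nonneg ha _ _) ?_
    rw [sub_nonneg, div_le_one hD, den_eq]
    nlinarith
  have h2 : 0 ≤ leafCount ha n i * (((i : ℝ) + a) / den a n) :=
    mul_nonneg (leafCount_nonneg ha _ _) (by positivity)
  have h3 : 0 < properCount ha n i * (((i : ℝ) + a) / den a n) :=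
    mul_pos (properCount_pos ha n i h) (by positivity)
  linarith

/-- Finitely many positive numbers dominate a positive multiple of any other such family. -/
theorem exists_pos_le {f b : ℕ → ℝ} (N : ℕ) (hf : ∀ i < N, 0 < f i) (hb : ∀ i < N, 0 < b i) :
    ∃ δ : ℝ, 0 < δ ∧ ∀ i < N, δ * b i ≤ f i := by
  induction N with
  | zero => exact ⟨1, one_pos, fun i hi => absurd hi (Nat.not_lt_zero i)⟩
  | succ N ih =>
    obtain ⟨δ, hδ, h⟩ := ih (fun i hi => hf i (by omega)) (fun i hi => hb i (by omega))
    have hfN := hf N (by omega)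
    have hbN := hb N (by omega)
    refine ⟨min δ (f N / b N), lt_min hδ (by positivity), fun i hi => ?_⟩
    rcases Nat.lt_succ_iff_lt_or_eq.1 hi with h1 | rfl
    · exact (mul_le_mul_of_nonneg_right (min_le_left _ _) (hb i hi).le).trans (h i h1)
    · rw [← le_div_iff₀ hbN]; exact min_le_right _ _

/-- The cutoff factor makes the bound nonpositive beyond the cutoff, so at `n₀` only finitely many
positive counts matter. `den_mul_sub_le` shows that moving the cutoff preserves the subsolution. -/
theorem le_properCount {ρ : ℝ} (hρ : 0 < ρ) {n₀ : ℕ} (h1 : 1 ≤ n₀) (han : 1 ≤ a * n₀)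
    (hcut : ∀ n ≥ n₀, cutoff a ρ n + 2 ≤ n) :
    ∃ δ : ℝ, 0 < δ ∧ ∀ n ≥ n₀, ∀ i : ℕ,
      δ * den a n * ((i : ℝ) + a) ^ (-(2 + a)) * (1 - i / cutoff a ρ n) ≤
        properCount ha n i := by
  have hcpos : ∀ i : ℕ, 0 < ((i : ℝ) + a) ^ (-(2 + a)) :=
    fun i => Real.rpow_pos_of_pos (by positivity) _
  obtain ⟨δ₁, hδ₁, hbase⟩ := exists_pos_le (f := fun i => properCount ha n₀ i)
    (b := fun i => den a n₀ * ((i : ℝ) + a) ^ (-(2 + a))) (n₀ - 1)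
    (fun i hi => properCount_pos ha n₀ i (by omega))
    (fun i _ => mul_pos (den_pos' ha _) (hcpos i))
  have hc0 := hcpos 0
  set c₀ := (((0 : ℕ) : ℝ) + a) ^ (-(2 + a)) with hc₀
  have hlt := div_den_lt_one ha h1
  -- At `i = 0` the outflow `a` and the growth `a + 1` of `den` must be fed by the births alone.
  set δ₂ := (1 - a / den a n₀) / (c₀ * (1 + 2 * a)) with hδ₂
  have hδ₂0 : 0 < δ₂ := div_pos (by linarith) (by positivity)
  refine ⟨min δ₁ δ₂, lt_min hδ₁ hδ₂0, ?_⟩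
  set δ := min δ₁ δ₂ with hδdef
  have hδ : 0 < δ := lt_min hδ₁ hδ₂0
  intro n hn
  induction n, hn using Nat.le_induction with
  | base =>
    intro i
    have hR := cutoff_pos ha hρ n₀
    have hD := den_pos' ha n₀
    have hci := hcpos i
    by_cases hi : (i : ℝ) < cutoff a ρ n₀
    · have h2 : (i : ℝ) + 2 < n₀ := by linarith [hcut n₀ le_rfl]
      have h3 : i + 2 < n₀ := by exact_mod_cast h2
      have h4 := hbase i (by omega)
      have h5 : 1 - i / cutoff a ρ n₀ ≤ 1 := by
        have : 0 ≤ i / cutoff a ρ n₀ := by positivity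
        linarith
      calc _ ≤ δ * den a n₀ * ((i : ℝ) + a) ^ (-(2 + a)) * 1 := by gcongr
        _ = δ * (den a n₀ * ((i : ℝ) + a) ^ (-(2 + a))) := by ring
        _ ≤ δ₁ * (den a n₀ * ((i : ℝ) + a) ^ (-(2 + a))) := by gcongr; exact min_le_left _ _
        _ ≤ _ := h4
    · refine le_trans (mul_nonpos_of_nonneg_of_nonpos (by positivity) ?_)
        (properCount_nonneg ha _ _)
      rw [sub_nonpos, one_le_div hR]; linarith
  | succ n hn ih =>
    intro i
    have hR := cutoff_pos ha hρ n
    have hR' := cutoff_pos ha hρ (n + 1)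
    have hD := den_pos' ha n
    have hD' := den_pos' ha (n + 1)
    have hci := hcpos i
    have hn0 : (n₀ : ℝ) ≤ n := by exact_mod_cast hn
    have han' : 1 ≤ a * n := han.trans (mul_le_mul_of_nonneg_left hn0 ha.le)
    have hgrow := den_mul_sub_le ha hρ n
    by_cases hi : (i : ℝ) < cutoff a ρ (n + 1)
    swap
    · refine le_trans (mul_nonpos_of_nonneg_of_nonpos (by positivity) ?_)
        (properCount_nonneg ha _ _)
      rw [sub_nonpos, one_le_div hR']; linarith
    have hin : (i : ℝ) ≤ n + 1 := by
      have := hcut (n + 1) (by omega)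
      push_cast at this
      linarith
    have hfac : 0 ≤ 1 - (i + a) / den a n := by
      rw [sub_nonneg, div_le_one hD]
      exact add_le_den han' hin
    rw [properCount_succ]
    have h2 := mul_le_mul_of_nonneg_right (ih i) hfac
    set D := den a n with hDdef
    set c := ((i : ℝ) + a) ^ (-(2 + a)) with hc
    set ε := 1 / cutoff a ρ n with hε
    set ε' := 1 / cutoff a ρ (n + 1) with hε'
    have e1 : ∀ u : ℝ, u / cutoff a ρ n = u * ε := fun u => by rw [hε]; ring
    have e2 : ∀ u : ℝ, u / cutoff a ρ (n + 1) = u * ε' := fun u => by rw [hε']; ring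
    have hε0 : 0 < ε := by positivity
    have e3 : δ * D * c * (1 - i / cutoff a ρ n) * (1 - (i + a) / D) =
        δ * c * ((1 - i * ε) * (D - (i + a))) := by rw [e1]; field_simp
    rw [e3] at h2
    have hg2 : δ * c * (den a (n + 1) * (1 - i * ε')) ≤
        δ * c * ((D + a + 1) * (1 - i * ε) + i * ε) := by
      refine mul_le_mul_of_nonneg_left ?_ (by positivity)
      have := mul_le_mul_of_nonneg_left hgrow (Nat.cast_nonneg (α := ℝ) i)
      rw [hDdef, ← den_succ]
      linarith
    rw [e2]
    rcases i with _ | i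
    · simp only [Nat.cast_zero] at h2 hg2 ⊢
      rw [properCount_of_neg ha n (x := 0 - 1) (by norm_num)]
      simp only [zero_mul, if_true, sub_zero, mul_one, add_zero, zero_add] at h2 hg2 ⊢
      have hDn : den a n₀ ≤ D := by
        rw [hDdef, den_eq, den_eq]; nlinarith
      have h3 : a / D ≤ a / den a n₀ := div_le_div_of_nonneg_left ha.le (den_pos' ha _) hDn
      have hcc : c = c₀ := rfl
      have h4 : δ * c * (1 + 2 * a) ≤ 1 - a / den a n₀ := by
        have : δ ≤ δ₂ := min_le_right _ _
        rw [hδ₂, le_div_iff₀ (by positivity)] at this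
        rw [hcc]; linarith
      linarith
    · have e : ((i + 1 : ℕ) : ℝ) - 1 = i := by push_cast; ring
      have h3 : ((i + 1 : ℕ) : ℝ) ≠ 0 := by positivity
      rw [e, if_neg h3]
      have h4 := mul_le_mul_of_nonneg_right (ih i)
        (show 0 ≤ (i + a) / D by positivity)
      have h5 := le_succ_rpow (r := 2 + a) (z := i + a) (by linarith) (by positivity)
      set c' := ((i : ℝ) + a) ^ (-(2 + a)) with hc'
      have e4 : δ * D * c' * (1 - i / cutoff a ρ n) * ((i + a) / D) =
        δ * (1 - i * ε) * ((i + a) * c') := by rw [e1]; field_simp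
      rw [e4] at h4
      have e5 : ((i : ℝ) + a + 1) ^ (-(2 + a)) = c := by
        rw [hc]; congr 1; push_cast; ring
      rw [e5] at h5
      have hY : 0 ≤ 1 - i * ε := by
        have h6 : (i : ℝ) + 1 < cutoff a ρ (n + 1) := by push_cast at hi; exact hi
        have h7 := le_cutoff_of_succ ha hρ (hcut n hn) h6.le
        rw [hε, mul_one_div, sub_nonneg, div_le_one hR]
        exact h7
      have h6 := mul_le_mul_of_nonneg_left h5 (show 0 ≤ δ * (1 - i * ε) by positivity)
      have h7 : 0 ≤ δ * c * ε * (1 + 2 * a) := by positivity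
      push_cast at h2 hg2 ⊢
      linarith

set_option maxHeartbeats 600000 in
theorem le_leafCount {ρ : ℝ} (hρ : 0 < ρ) :
    ∃ κ : ℝ, 0 < κ ∧ ∃ n₁ : ℕ, 1 ≤ n₁ ∧ ∀ n ≥ n₁, ∀ i : ℕ,
      κ * den a n * ((i : ℝ) + 1 + a) ^ (-(1 + a)) * (1 - (i + 1) / cutoff a ρ n) ≤
        leafCount ha n (i + 1) := by
  obtain ⟨n₀, h1, han, hcut⟩ := eventually_cutoff_le ha hρ
  obtain ⟨δ, hδ, hproper⟩ := le_properCount ha hρ h1 han hcut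
  have hcpos : ∀ i : ℕ, 0 < ((i : ℝ) + 1 + a) ^ (-(1 + a)) :=
    fun i => Real.rpow_pos_of_pos (by positivity) _
  obtain ⟨κ₁, hκ₁, hbase⟩ := exists_pos_le (f := fun i => leafCount ha (n₀ + 1) (i + 1))
    (b := fun i => den a (n₀ + 1) * ((i : ℝ) + 1 + a) ^ (-(1 + a))) (n₀ - 1)
    (fun i hi => leafCount_pos ha n₀ i han (by omega))
    (fun i _ => mul_pos (den_pos' ha _) (hcpos i))
  -- At weight `y`, outflow `y + 2 * a` and growth `a + 1` exceed the inflow rate `y - 1 + a` by `2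
  -- * a + 2`. At weight 1 the inflow is discarded and `3 * a + 2` is needed. The births must cover
  -- both.
  set κ₂ := δ / (3 * a + 3) with hκ₂
  have hκ₂0 : 0 < κ₂ := by positivity
  refine ⟨min κ₁ κ₂, lt_min hκ₁ hκ₂0, n₀ + 1, by omega, ?_⟩
  set κ := min κ₁ κ₂ with hκdef
  have hκ : 0 < κ := lt_min hκ₁ hκ₂0
  have hκδ : κ * (3 * a + 3) ≤ δ := by
    have : κ ≤ κ₂ := min_le_right _ _
    rwa [hκ₂, le_div_iff₀ (by positivity)] at this
  intro n hn
  induction n, hn using Nat.le_induction with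
  | base =>
    intro i
    have hR := cutoff_pos ha hρ (n₀ + 1)
    have hD := den_pos' ha (n₀ + 1)
    have hci := hcpos i
    by_cases hi : (i : ℝ) + 1 < cutoff a ρ (n₀ + 1)
    · have h2 : (i : ℝ) + 2 < n₀ := by
        have := hcut (n₀ + 1) (by omega)
        push_cast at this
        linarith
      have h3 : i + 2 < n₀ := by exact_mod_cast h2
      have h4 := hbase i (by omega)
      have h5 : 1 - (i + 1) / cutoff a ρ (n₀ + 1) ≤ 1 := by
        have : 0 ≤ ((i : ℝ) + 1) / cutoff a ρ (n₀ + 1) := by positivity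
        linarith
      calc _ ≤ κ * den a (n₀ + 1) * ((i : ℝ) + 1 + a) ^ (-(1 + a)) * 1 := by gcongr
        _ = κ * (den a (n₀ + 1) * ((i : ℝ) + 1 + a) ^ (-(1 + a))) := by ring
        _ ≤ κ₁ * (den a (n₀ + 1) * ((i : ℝ) + 1 + a) ^ (-(1 + a))) := by
            gcongr; exact min_le_left _ _
        _ ≤ _ := h4
    · refine le_trans (mul_nonpos_of_nonneg_of_nonpos (by positivity) ?_)
        (leafCount_nonneg ha _ _)
      rw [sub_nonpos, one_le_div hR]; linarith
  | succ n hn ih =>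
    intro i
    have hR := cutoff_pos ha hρ n
    have hR' := cutoff_pos ha hρ (n + 1)
    have hD := den_pos' ha n
    have hD' := den_pos' ha (n + 1)
    have hci := hcpos i
    have hgrow := den_mul_sub_le ha hρ n
    by_cases hi : (i : ℝ) + 1 < cutoff a ρ (n + 1)
    swap
    · refine le_trans (mul_nonpos_of_nonneg_of_nonpos (by positivity) ?_)
        (leafCount_nonneg ha _ _)
      rw [sub_nonpos, one_le_div hR']; linarith
    have hin : (i : ℝ) + 1 ≤ n := by
      have := hcut (n + 1) (by omega)
      push_cast at this
      linarith
    have hn1 : (1 : ℝ) ≤ n := by exact_mod_cast (show 1 ≤ n by omega)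
    have hfac : 0 ≤ 1 - ((i : ℝ) + 1 + 2 * a) / den a n := by
      rw [sub_nonneg, div_le_one hD, den_eq]
      nlinarith
    have hiR := le_cutoff_of_succ ha hρ (hcut n (by omega)) hi.le
    rw [leafCount_succ, show (i : ℝ) + 1 - 1 = i by ring]
    have h2 := mul_le_mul_of_nonneg_right (ih i) hfac
    have h3 := mul_le_mul_of_nonneg_right (hproper n (by omega) i)
      (show 0 ≤ ((i : ℝ) + a) / den a n by positivity)
    set D := den a n with hDdef
    set c := ((i : ℝ) + 1 + a) ^ (-(1 + a)) with hc
    set ε := 1 / cutoff a ρ n with hε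
    set ε' := 1 / cutoff a ρ (n + 1) with hε'
    have e1 : ∀ u : ℝ, u / cutoff a ρ n = u * ε := fun u => by rw [hε]; ring
    have e2 : ∀ u : ℝ, u / cutoff a ρ (n + 1) = u * ε' := fun u => by rw [hε']; ring
    have hε0 : 0 < ε := by positivity
    have hY : 0 ≤ 1 - i * ε := by
      rw [← e1, sub_nonneg, div_le_one hR]
      exact hiR
    have hia : 0 < (i : ℝ) + a := by positivity
    set x := ((i : ℝ) + a) ^ (-(1 + a)) with hx
    have hcx : c ≤ x := Real.rpow_le_rpow_of_nonpos hia (by linarith) (by linarith)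
    have e3 : κ * D * c * (1 - (i + 1) / cutoff a ρ n) * (1 - ((i : ℝ) + 1 + 2 * a) / D) =
        κ * c * ((1 - (i + 1) * ε) * (D - (i + 1 + 2 * a))) := by rw [e1]; field_simp
    have e4 : δ * D * ((i : ℝ) + a) ^ (-(2 + a)) * (1 - i / cutoff a ρ n) * ((i + a) / D) =
        δ * x * (1 - i * ε) := by
      have : x = ((i : ℝ) + a) ^ (-(2 + a)) * (i + a) := by
        rw [hx, ← Real.rpow_add_one hia.ne']; ring_nf
      rw [this, e1]; field_simp
    rw [e3] at h2
    rw [e4] at h3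
    have hg2 : κ * c * (den a (n + 1) * (1 - (i + 1) * ε')) ≤
        κ * c * ((D + a + 1) * (1 - (i + 1) * ε) + (i + 1) * ε) := by
      refine mul_le_mul_of_nonneg_left ?_ (by positivity)
      have := mul_le_mul_of_nonneg_left hgrow (show (0 : ℝ) ≤ i + 1 by positivity)
      rw [hDdef, ← den_succ]
      linarith
    rw [e2]
    have hx0 : 0 < x := hci.trans_le hcx
    rcases i with _ | i
    · simp only [Nat.cast_zero, zero_add, zero_mul, sub_zero, mul_one, one_mul] at h2 h3 hg2 ⊢
      have h4 : 0 ≤ leafCount ha n 0 * (a / D) :=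
        mul_nonneg (leafCount_nonneg ha _ _) (by positivity)
      have h5 : κ * c * (3 * a + 3) ≤ δ * x :=
        calc κ * c * (3 * a + 3) = κ * (3 * a + 3) * c := by ring
          _ ≤ δ * x := mul_le_mul hκδ hcx hci.le hδ.le
      have h6 : 0 ≤ κ * c * (ε * (3 * a + 1) + 1) := by positivity
      linarith
    · have e5 : (((i + 1 : ℕ) : ℝ)) = i + 1 := by push_cast; ring
      have h4 := mul_le_mul_of_nonneg_right (ih i)
        (show 0 ≤ (((i + 1 : ℕ) : ℝ) + a) / D by positivity)
      have e6 : κ * D * ((i : ℝ) + 1 + a) ^ (-(1 + a)) * (1 - (i + 1) / cutoff a ρ n) *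
          ((((i + 1 : ℕ) : ℝ) + a) / D) = κ * x * (i + 1 + a) * (1 - (i + 1) * ε) := by
        rw [hx, e5, e1]; field_simp
      rw [e6] at h4
      rw [e5] at h2 h3 h4 hg2 hY ⊢
      have h5 : κ * c * ((i + 1 + 1 + 3 * a + 1) * (1 - (i + 1) * ε)) ≤
          (κ * (i + 1 + a) + δ) * x * (1 - (i + 1) * ε) := by
        have h6 : κ * ((i : ℝ) + 1 + 1 + 3 * a + 1) ≤ κ * (i + 1 + a) + δ := by
          nlinarith
        calc _ = κ * ((i : ℝ) + 1 + 1 + 3 * a + 1) * c * (1 - (i + 1) * ε) := by ring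
          _ ≤ (κ * (i + 1 + a) + δ) * x * (1 - (i + 1) * ε) :=
              mul_le_mul_of_nonneg_right (mul_le_mul h6 hcx hci.le (by positivity)) hY
      have h7 : 0 ≤ κ * c * ε * (3 * a + 1) := by positivity
      linarith

theorem le_expectedX_const {C : ℝ} (hC : 0 < C) : ∃ c : ℝ, 0 < c ∧ ∃ n₁ : ℕ, 1 ≤ n₁ ∧
    ∀ n ≥ n₁, ∀ k : ℕ, 1 ≤ k → (k : ℝ) ≤ C * (n : ℝ) ^ (1 / (1 + a)) →
      c * ((n : ℝ) / (k : ℝ) ^ (1 + a)) ≤ expectedX ha n k := by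
  -- With `ρ = 2 * C` every admissible `k` is at most half the cutoff, so the cutoff factor is at
  -- least `1 / 2`.
  obtain ⟨κ, hκ, n₁, hn₁, h⟩ := le_leafCount ha (ρ := 2 * C) (by positivity)
  have h1a : 0 < (1 + a) ^ (-(1 + a)) := Real.rpow_pos_of_pos (by linarith) _
  refine ⟨κ / 2 * (1 + a) ^ (-(1 + a)), by positivity, n₁, hn₁, ?_⟩
  intro n hn k hk hkC
  obtain ⟨i, rfl⟩ : ∃ i, k = i + 1 := ⟨k - 1, by omega⟩
  have h1 := (h n hn i)
  have h2 := leafCount_le_expectedX ha n (i + 1)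
  push_cast at h2 hkC ⊢
  refine le_trans (le_trans ?_ h1) h2
  have hD : (n : ℝ) ≤ den a n := by
    rw [den_eq]
    have := mul_nonneg ha.le (Nat.cast_nonneg (α := ℝ) n)
    linarith
  have hR := cutoff_pos ha (show 0 < 2 * C by positivity) n
  have hnR : 2 * C * (n : ℝ) ^ (1 / (1 + a)) ≤ cutoff a (2 * C) n := by
    unfold cutoff
    have : (n : ℝ) ≤ den a n + a := by linarith
    gcongr
  have h3 : 1 / 2 ≤ 1 - ((i : ℝ) + 1) / cutoff a (2 * C) n := by
    have : ((i : ℝ) + 1) / cutoff a (2 * C) n ≤ 1 / 2 := by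
      rw [div_le_iff₀ hR]; linarith
    linarith
  have hi : (0 : ℝ) ≤ i := Nat.cast_nonneg i
  have h4 : (1 + a) ^ (-(1 + a)) * ((i : ℝ) + 1) ^ (-(1 + a)) ≤
      ((i : ℝ) + 1 + a) ^ (-(1 + a)) := by
    rw [← Real.mul_rpow (by linarith) (by linarith)]
    refine Real.rpow_le_rpow_of_nonpos (by linarith) ?_ (by linarith)
    nlinarith [mul_nonneg ha.le hi]
  have hip : 0 < ((i : ℝ) + 1) ^ (-(1 + a)) := Real.rpow_pos_of_pos (by linarith) _
  have hn0 : (0 : ℝ) ≤ n := Nat.cast_nonneg n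
  have hD0 := den_pos' ha n
  have hq : 0 < ((i : ℝ) + 1 + a) ^ (-(1 + a)) := Real.rpow_pos_of_pos (by linarith) _
  calc κ / 2 * (1 + a) ^ (-(1 + a)) * ((n : ℝ) / ((i : ℝ) + 1) ^ (1 + a))
      = κ * n * ((1 + a) ^ (-(1 + a)) * ((i : ℝ) + 1) ^ (-(1 + a))) * (1 / 2) := by
        rw [Real.rpow_neg (show (0 : ℝ) ≤ i + 1 by linarith)]; ring
    _ ≤ κ * den a n * ((i : ℝ) + 1 + a) ^ (-(1 + a)) *
        (1 - ((i : ℝ) + 1) / cutoff a (2 * C) n) := by gcongr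

end BuckleyOsthus

end

theorem corollary2 (a : ℝ) (ha : 0 < a) (C : ℝ) (hC : 0 < C) :
    ∃ c₁ c₂ : ℝ, 0 < c₁ ∧ 0 < c₂ ∧ ∃ n₀ : ℕ, ∀ n : ℕ, n₀ ≤ n → ∀ k : ℕ, 1 ≤ k →
      (k : ℝ) ≤ C * (n : ℝ) ^ (1 / (1 + a)) →
        c₁ * ((n : ℝ) / (k : ℝ) ^ (1 + a)) ≤ BuckleyOsthus.expectedX ha n k ∧
        BuckleyOsthus.expectedX ha n k ≤ c₂ * ((n : ℝ) / (k : ℝ) ^ (1 + a)) := by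
  obtain ⟨c₁, hc₁, n₁, hn₁, hlow⟩ := BuckleyOsthus.le_expectedX_const ha hC
  obtain ⟨c₂, hc₂, hup⟩ := BuckleyOsthus.expectedX_le_const ha
  exact ⟨c₁, c₂, hc₁, hc₂, n₁, fun n hn k hk hkC =>
    ⟨hlow n hn k hk hkC, hup n k (hn₁.trans hn) hk⟩⟩
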